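/- For a finite set $V$, a *$d$-hypergraph* $H=(V,E)$ consists of the vertex set $V$ and a finite multiset $E$ of subsets of $V$ of size at most $d$, called edges. For $H=([n],E)$ let $p_H(x_1,\dots,x_n)=\sum_{e\in E}\prod_{i\in e}x_i\in\mathbb{R}[x_1,\dots,x_n]$, where the sum counts edges with multiplicity, and let $\nabla p_H:\mathbb{R}^n\to\mathbb{R}^n$ be its gradient, $(\nabla p_H)_i=\partial p_H/\partial x_i$. The Gaussian width of a set $T\subseteq\mathbb{R}^n$ is $\mathrm{gw}(T)=\mathbb{E}\big[\sup_{x\in T}\langle x,g\rangle\big]$, where $g$ is a standard Gaussian vector in $\mathbb{R}^n$. **Corollary.** For every positive integer $d$ there is a constant $C_d\in(0,\infty)$, depending only on $d$, such that the following holds for all positive integers $n,t$. Let $H=([n],E)$ be a $(d+1)$-hypergraph such that for every pair of distinct vertices $i,j\in[n]$ at most $t$ edges of $H$ (counted with multiplicity) contain both $i$ and $j$. Then $$\frac1n\,\mathrm{gw}\big((\nabla p_H)(\{0,1\}^n)\big)\le C_d\, t\, n^{1-\frac{1}{2\lceil d/2\rceil}}\sqrt{\log n}.$$ -/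

import Mathlib

open MeasureTheory ProbabilityTheory

/-- The Gaussian width `E [sup_{x ∈ T} ⟨x, g⟩]` of a set `T ⊆ ℝ^ι`, where `g` is a standard Gaussian
vector. It is meaningful for nonempty `T` with integrable supremum, in particular for nonempty
finite `T`, see `integrable_sSup_inner_of_finite`. -/
noncomputable def gaussianWidth {ι : Type*} [Fintype ι] (T : Set (EuclideanSpace ℝ ι)) : ℝ :=
  ∫ g, sSup ((fun x => inner ℝ x g) '' T) ∂(stdGaussian (EuclideanSpace ℝ ι))

/-- The random variable inside `gaussianWidth` is integrable when `T` is finite and nonempty. -/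
theorem integrable_sSup_inner_of_finite {ι : Type*} [Fintype ι] {T : Set (EuclideanSpace ℝ ι)}
    (hT : T.Finite) (hne : T.Nonempty) :
    Integrable (fun g => sSup ((fun x => inner ℝ x g) '' T))
      (stdGaussian (EuclideanSpace ℝ ι)) := by
  lift T to Finset (EuclideanSpace ℝ ι) using hT
  have hne' : T.Nonempty := by simpa using hne
  have h : ∀ g : EuclideanSpace ℝ ι, sSup ((fun x => inner ℝ x g) '' (T : Set _)) =
      T.sup' hne' (fun x => inner ℝ x g) := fun g => by
    rw [Finset.sup'_eq_csSup_image]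
  simp_rw [h]
  clear h hne
  induction hne' using Finset.Nonempty.cons_induction with
  | singleton a =>
    simp only [Finset.sup'_singleton]
    exact (IsGaussian.integrable_id (μ := stdGaussian (EuclideanSpace ℝ ι))).const_inner a
  | cons a s ha hs ih =>
    simp only [Finset.sup'_cons hs]
    exact ((IsGaussian.integrable_id
      (μ := stdGaussian (EuclideanSpace ℝ ι))).const_inner a).sup ih

/-- A hypergraph on the vertex set `V`: a multiset of finite subsets of `V`, called the edges
(so parallel edges, singletons and the empty edge are allowed). -/
structure MultiHypergraph (V : Type*) where
  edges : Multiset (Finset V)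

namespace MultiHypergraph

/-- `H` is a `d`-hypergraph: every edge has at most `d` vertices. -/
def IsBounded {V : Type*} (H : MultiHypergraph V) (d : ℕ) : Prop :=
  ∀ e ∈ H.edges, e.card ≤ d

/-- The number of edges, counted with multiplicity, that contain both `i` and `j`. -/
def codegree {V : Type*} [DecidableEq V] (H : MultiHypergraph V) (i j : V) : ℕ :=
  H.edges.countP (fun e => i ∈ e ∧ j ∈ e)

/-- The multilinear polynomial `p_H = ∑_{e ∈ E} ∏_{i ∈ e} x_i`. -/
noncomputable def poly {V : Type*} (H : MultiHypergraph V) : MvPolynomial V ℝ :=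
  (H.edges.map fun e => ∏ i ∈ e, MvPolynomial.X i).sum

end MultiHypergraph

/-- The gradient of a real polynomial in the variables `x_i`, `i ∈ ι`, as a map `ℝ^ι → ℝ^ι`. -/
noncomputable def polyGradient {ι : Type*} (p : MvPolynomial ι ℝ)
    (x : EuclideanSpace ℝ ι) : EuclideanSpace ℝ ι :=
  WithLp.toLp 2 fun i => MvPolynomial.eval (fun j => x j) (MvPolynomial.pderiv i p)

/-- The Boolean hypercube `{0,1}^ι` inside `ℝ^ι`. -/
def booleanCube (ι : Type*) : Set (EuclideanSpace ℝ ι) :=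
  {x | ∀ i, x i = 0 ∨ x i = 1}

theorem finite_booleanCube (ι : Type*) [Fintype ι] : (booleanCube ι).Finite := by
  have h : (Set.univ.pi fun _ : ι => ({0, 1} : Set ℝ)).Finite :=
    Set.Finite.pi fun _ => Set.toFinite _
  refine (h.image (WithLp.toLp 2)).subset fun x hx => ?_
  exact ⟨fun i => x i, fun i _ => by simpa using hx i, rfl⟩

theorem nonempty_booleanCube (ι : Type*) : (booleanCube ι).Nonempty :=
  ⟨0, fun _ => Or.inl rfl⟩

/-!
The gradient of `p_H` in direction `i` is, up to a constant, the sum of the monomials `x^e` over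
the link of `i`, i.e. over the nonempty sets `e \ {i}` with `i ∈ e`. The constants only shift the
supremum by a centred Gaussian variable. In a link every vertex has degree at most `t`, and every
edge has at most `2k` vertices, where `k = ⌈d/2⌉`.

Padding with dummy vertices, on which `x` is `1`, splits each link edge into two halves of exactly
`k` vertices, without spoiling the degree bound (`exists_padded_enumeration`). The number of
vertices becomes `N = 2n`. Since all functions involved are multi-affine, `x` may be assumed to be
a sign vector (`exists_sign_sum_mul_prod_le`).

The link of `i` is then encoded in a symmetric matrix `A i`, indexed by the tables `u` of `k` rows
with `m` vertices each: `u` and `w` are adjacent through an edge if `w` arises from `u` by replacing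
one half of that edge, with one vertex in each row, by the other half. For a sign vector the
character `y_u = ∏ x_{u(a,q)}` satisfies `y_u y_w = x^e` across such an adjacency, so `yᵀ A y` is
proportional to `∑ x^e`. Dividing each entry by the sum of the degrees of `u` and `w` makes `A i` a
contraction (`isContraction_kikuchiMatrix`). It reweights the edges, but as long as
`m ^ k ≤ N ^ (k - 1)` a table that contains half of a given edge has average degree `O(t)`
(`sum_hits_mul_hitDegree_le`), so by convexity no edge loses more than a factor `O(t)`
(`le_edgeWeight`), and coefficients at most `1` restore equal weights.

It remains to bound the norm of `∑ g_i A_i` for contractions `A_i` of size `D = N ^ (k m)`. Gaussian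
integration by parts and `tr (A X^q A X^r) ≤ tr X^(q+r)` give
`E tr X^(2p+2) ≤ (2p+1) n E tr X^(2p)` (`integral_trace_pow_succ_le`), hence a norm of order
`√(n log D) = √(n k m log N)`. With `m` about `N ^ (1 - 1/k)` this is the bound claimed.
-/

/-! ### Gaussian integration by parts for polynomials -/

theorem integrable_pow_gaussianReal (k : ℕ) :
    Integrable (fun x : ℝ => x ^ k) (gaussianReal 0 1) := by
  rcases Nat.eq_zero_or_pos k with rfl | hk
  · simp
  · have h := (memLp_id_gaussianReal (μ := 0) (v := 1) k).integrable_norm_pow hk.ne'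
    refine h.mono' (by fun_prop) (ae_of_all _ fun x => ?_)
    simp

theorem integrable_pow_mul_gaussianPDFReal (k : ℕ) :
    Integrable (fun x : ℝ => x ^ k * gaussianPDFReal 0 1 x) := by
  have h := integrable_pow_gaussianReal k
  rw [gaussianReal_of_var_ne_zero 0 one_ne_zero,
    integrable_withDensity_iff (measurable_gaussianPDF 0 1) (ae_of_all _ fun _ => by
      simp [gaussianPDF])] at h
  simpa [toReal_gaussianPDF] using h

theorem hasDerivAt_gaussianPDFReal_zero_one (x : ℝ) :
    HasDerivAt (gaussianPDFReal 0 1) (-x * gaussianPDFReal 0 1 x) x := by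
  have h : HasDerivAt (fun x : ℝ => -(x - 0) ^ 2 / (2 * ((1 : NNReal) : ℝ))) (-x) x := by
    refine ((((hasDerivAt_id' x).sub_const 0).fun_pow 2).fun_neg.div_const _).congr_deriv ?_
    push_cast
    ring
  rw [gaussianPDFReal_def]
  refine (h.exp.const_mul _).congr_deriv ?_
  ring

/-- The recursion of the Gaussian moments. For `k = 0` the truncated exponent `k - 1` is harmless,
because of the factor `k`. -/
theorem integral_pow_succ_gaussianReal (k : ℕ) :
    ∫ x, x ^ (k + 1) ∂gaussianReal 0 1 = k * ∫ x, x ^ (k - 1) ∂gaussianReal 0 1 := by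
  rw [integral_gaussianReal_eq_integral_smul one_ne_zero,
    integral_gaussianReal_eq_integral_smul one_ne_zero]
  have key := integral_mul_deriv_eq_deriv_mul_of_integrable
    (u := fun x : ℝ => x ^ k) (v := gaussianPDFReal 0 1)
    (u' := fun x => (k : ℝ) * x ^ (k - 1)) (v' := fun x => -x * gaussianPDFReal 0 1 x)
    (fun x _ => by simpa using hasDerivAt_pow k x)
    (fun x _ => hasDerivAt_gaussianPDFReal_zero_one x)
    (by
      refine (integrable_pow_mul_gaussianPDFReal (k + 1)).neg.congr (ae_of_all _ fun x => ?_)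
      simp only [Pi.neg_apply, Pi.mul_apply]; ring)
    (by
      refine ((integrable_pow_mul_gaussianPDFReal (k - 1)).const_mul (k : ℝ)).congr
        (ae_of_all _ fun x => ?_)
      simp only [Pi.mul_apply]; ring)
    (integrable_pow_mul_gaussianPDFReal k)
  calc ∫ x, gaussianPDFReal 0 1 x • x ^ (k + 1)
      = -∫ x, x ^ k * (-x * gaussianPDFReal 0 1 x) := by
        rw [← integral_neg]; congr 1; ext x; simp only [smul_eq_mul]; ring
    _ = ∫ x, (k : ℝ) * x ^ (k - 1) * gaussianPDFReal 0 1 x := by rw [key, neg_neg]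
    _ = _ := by
        rw [← integral_const_mul]; congr 1; ext x; simp only [smul_eq_mul]; ring

section Stein
variable {ι : Type*} [Fintype ι]

theorem integrable_eval_pi_gaussianReal (p : MvPolynomial ι ℝ) :
    Integrable (fun g : ι → ℝ => MvPolynomial.eval g p)
      (Measure.pi fun _ : ι => gaussianReal 0 1) := by
  induction p using MvPolynomial.induction_on' with
  | monomial s c =>
    simp only [MvPolynomial.eval_monomial, Finsupp.prod_fintype _ _ (fun _ => pow_zero _)]
    exact (Integrable.fintype_prod fun i => integrable_pow_gaussianReal (s i)).const_mul c
  | add p q hp hq =>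
    simp only [map_add]
    exact hp.add hq

theorem integral_X_mul_eval_pi_gaussianReal (i : ι) (p : MvPolynomial ι ℝ) :
    ∫ g : ι → ℝ, g i * MvPolynomial.eval g p ∂(Measure.pi fun _ : ι => gaussianReal 0 1) =
      ∫ g : ι → ℝ, MvPolynomial.eval g (MvPolynomial.pderiv i p)
        ∂(Measure.pi fun _ : ι => gaussianReal 0 1) := by
  classical
  induction p using MvPolynomial.induction_on' with
  | monomial s c =>
    have hl : ∀ g : ι → ℝ, g i * MvPolynomial.eval g (MvPolynomial.monomial s c) =
        c * ∏ j, g j ^ (s j + if j = i then 1 else 0) := fun g => by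
      simp only [MvPolynomial.eval_monomial, Finsupp.prod_fintype _ _ (fun _ => pow_zero _),
        pow_add, Finset.prod_mul_distrib, pow_ite, pow_one, pow_zero, Finset.prod_ite_eq',
        Finset.mem_univ, if_true]
      ring
    have hr : ∀ g : ι → ℝ,
        MvPolynomial.eval g (MvPolynomial.pderiv i (MvPolynomial.monomial s c)) =
        c * s i * ∏ j, g j ^ (s j - if j = i then 1 else 0) := fun g => by
      simp only [MvPolynomial.pderiv_monomial, MvPolynomial.eval_monomial,
        Finsupp.prod_fintype _ _ (fun _ => pow_zero _), Finsupp.tsub_apply,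
        Finsupp.single_apply, eq_comm]
    simp only [hl, hr, integral_const_mul]
    rw [integral_fintype_prod_eq_prod (fun j (x : ℝ) => x ^ (s j + if j = i then 1 else 0)),
      integral_fintype_prod_eq_prod (fun j (x : ℝ) => x ^ (s j - if j = i then 1 else 0)),
      ← Finset.mul_prod_erase _ _ (Finset.mem_univ i), mul_assoc,
      ← Finset.mul_prod_erase _ (fun j => ∫ x : ℝ, x ^ (s j - if j = i then 1 else 0) ∂_)
        (Finset.mem_univ i)]
    simp only [if_true, integral_pow_succ_gaussianReal, ← mul_assoc]
    congr 1
    refine Finset.prod_congr rfl fun j hj => ?_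
    simp [Finset.ne_of_mem_erase hj]
  | add p q hp hq =>
    have h : ∀ r : MvPolynomial ι ℝ, Integrable (fun g : ι → ℝ => g i * MvPolynomial.eval g r)
        (Measure.pi fun _ : ι => gaussianReal 0 1) := fun r => by
      refine (integrable_eval_pi_gaussianReal (MvPolynomial.X i * r)).congr
        (ae_of_all _ fun g => ?_)
      simp
    simp only [map_add, mul_add]
    rw [integral_add (h p) (h q), hp, hq, integral_add (integrable_eval_pi_gaussianReal _)
      (integrable_eval_pi_gaussianReal _)]

theorem integrable_eval_stdGaussian (p : MvPolynomial ι ℝ) :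
    Integrable (fun g : EuclideanSpace ℝ ι => MvPolynomial.eval (fun i => g i) p)
      (stdGaussian (EuclideanSpace ℝ ι)) := by
  rw [← map_pi_eq_stdGaussian]
  exact (MeasurableEquiv.toLp 2 (ι → ℝ)).measurableEmbedding.integrable_map_iff.2
    (integrable_eval_pi_gaussianReal p)

/-- Stein's identity `E [g_i p(g)] = E [∂_i p(g)]` (Gaussian integration by parts) for
polynomials. -/
theorem integral_X_mul_eval_stdGaussian (i : ι) (p : MvPolynomial ι ℝ) :
    ∫ g : EuclideanSpace ℝ ι, g i * MvPolynomial.eval (fun i => g i) p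
        ∂(stdGaussian (EuclideanSpace ℝ ι)) =
      ∫ g : EuclideanSpace ℝ ι, MvPolynomial.eval (fun i => g i) (MvPolynomial.pderiv i p)
        ∂(stdGaussian (EuclideanSpace ℝ ι)) := by
  have h : ∀ f : EuclideanSpace ℝ ι → ℝ, ∫ g, f g ∂(stdGaussian (EuclideanSpace ℝ ι)) =
      ∫ g : ι → ℝ, f (WithLp.toLp 2 g) ∂(Measure.pi fun _ : ι => gaussianReal 0 1) := fun f => by
    rw [← map_pi_eq_stdGaussian]
    exact (MeasurableEquiv.toLp 2 (ι → ℝ)).measurableEmbedding.integral_map f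
  rw [h, h]
  exact integral_X_mul_eval_pi_gaussianReal i p

end Stein

/-! ### A matrix Khintchine inequality by the trace method -/

section Khintchine
open Matrix
variable {I : Type*} [Fintype I] [DecidableEq I]

/-- The spectral theorem, in the form of one orthogonal matrix that diagonalizes all powers. -/
theorem Matrix.IsSymm.exists_diagonalization {X : Matrix I I ℝ} (hX : X.IsSymm) :
    ∃ (U : Matrix I I ℝ) (l : I → ℝ), Uᵀ * U = 1 ∧ U * Uᵀ = 1 ∧
      ∀ q : ℕ, X ^ q = U * diagonal (fun u => l u ^ q) * Uᵀ := by
  have hH : X.IsHermitian := by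
    rw [Matrix.IsHermitian, conjTranspose_eq_transpose_of_trivial]; exact hX
  set U : Matrix I I ℝ := (hH.eigenvectorUnitary : Matrix I I ℝ) with hU
  have h1 : Uᵀ * U = 1 := by
    have := Unitary.coe_star_mul_self hH.eigenvectorUnitary
    rwa [star_eq_conjTranspose, conjTranspose_eq_transpose_of_trivial] at this
  have h2 : U * Uᵀ = 1 := by
    exact mul_eq_one_comm.1 h1
  have hX1 : X = U * diagonal hH.eigenvalues * Uᵀ := by
    have := hH.spectral_theorem
    rw [Unitary.conjStarAlgAut_apply, star_eq_conjTranspose,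
      conjTranspose_eq_transpose_of_trivial] at this
    exact this
  generalize hH.eigenvalues = l at hX1
  refine ⟨U, l, h1, h2, fun q => ?_⟩
  induction q with
  | zero => simp [h2]
  | succ q ih =>
    rw [pow_succ, ih]
    nth_rw 1 [hX1]
    calc U * diagonal (fun u => l u ^ q) * Uᵀ * (U * diagonal l * Uᵀ)
        = U * (diagonal (fun u => l u ^ q) * (Uᵀ * U) *
            diagonal l) * Uᵀ := by simp only [Matrix.mul_assoc]
      _ = _ := by simp only [h1, Matrix.mul_one, diagonal_mul_diagonal, pow_succ]

theorem Matrix.trace_conj_diagonal {U : Matrix I I ℝ} (hU : Uᵀ * U = 1) (l : I → ℝ) :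
    (U * diagonal l * Uᵀ).trace = ∑ u, l u := by
  rw [trace_mul_comm, ← Matrix.mul_assoc, hU, Matrix.one_mul, trace_diagonal]

/-- The rearrangement inequality for even total exponent; `q` and `r` may be odd and `a`, `b`
negative. -/
theorem pow_mul_pow_add_pow_mul_pow_le (a b : ℝ) {p q r : ℕ} (h : q + r = 2 * p) :
    a ^ q * b ^ r + a ^ r * b ^ q ≤ a ^ (2 * p) + b ^ (2 * p) := by
  have h1 : a ^ q * b ^ r + a ^ r * b ^ q ≤ |a| ^ q * |b| ^ r + |a| ^ r * |b| ^ q := by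
    simp only [← abs_pow, ← abs_mul]
    exact add_le_add (le_abs_self _) (le_abs_self _)
  have h2 : 0 ≤ (|a| ^ q - |b| ^ q) * (|a| ^ r - |b| ^ r) := by
    rcases le_total |a| |b| with hab | hab
    · exact mul_nonneg_of_nonpos_of_nonpos
        (sub_nonpos.2 (pow_le_pow_left₀ (abs_nonneg _) hab _))
        (sub_nonpos.2 (pow_le_pow_left₀ (abs_nonneg _) hab _))
    · exact mul_nonneg (sub_nonneg.2 (pow_le_pow_left₀ (abs_nonneg _) hab _))
        (sub_nonneg.2 (pow_le_pow_left₀ (abs_nonneg _) hab _))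
  have h3 : ∀ x : ℝ, x ^ (2 * p) = |x| ^ q * |x| ^ r := fun x => by
    rw [← pow_add, h, (even_two_mul p).pow_abs]
  rw [h3, h3]
  nlinarith

/-- A matrix is a contraction of the Euclidean norm. -/
def Matrix.IsContraction (A : Matrix I I ℝ) : Prop :=
  ∀ v : I → ℝ, (A *ᵥ v) ⬝ᵥ (A *ᵥ v) ≤ v ⬝ᵥ v

/-- All the terms of the derivative of `tr (A X ^ (2p+1))` in direction `A` are at most
`tr X ^ (2p)`. In an eigenbasis of `X` the left side is `∑ B_{uv}² λ_v^q λ_u^r` with a symmetric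
contraction `B`; after symmetrizing in `u` and `v`, the rearrangement inequality applies. -/
theorem Matrix.IsContraction.trace_mul_pow_mul_pow_le {A X : Matrix I I ℝ} (hA : A.IsContraction)
    (hAs : A.IsSymm) (hX : X.IsSymm) {p q r : ℕ} (h : q + r = 2 * p) :
    (A * X ^ q * A * X ^ r).trace ≤ (X ^ (2 * p)).trace := by
  obtain ⟨U, l, hU, -, hpow⟩ := hX.exists_diagonalization
  set B := Uᵀ * A * U with hB
  have hBs : ∀ u v, B u v = B v u := fun u v => by
    have : Bᵀ = B := by simp [hB, transpose_mul, hAs.eq, Matrix.mul_assoc]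
    rw [← this, transpose_apply, this]
  have hcol : ∀ v, ∑ u, B u v ^ 2 ≤ 1 := fun v => by
    have hBB : Bᵀ * B = (A * U)ᵀ * (A * U) := by
      have hUU : U * Uᵀ = 1 := mul_eq_one_comm.1 hU
      calc Bᵀ * B = (Uᵀ * Aᵀ) * (U * Uᵀ) * (A * U) := by
            simp only [hB, transpose_mul, transpose_transpose, Matrix.mul_assoc]
        _ = _ := by rw [hUU, Matrix.mul_one, transpose_mul]
    calc ∑ u, B u v ^ 2 = (Bᵀ * B) v v := by simp [mul_apply, sq]
      _ = (A *ᵥ fun w => U w v) ⬝ᵥ (A *ᵥ fun w => U w v) := by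
        rw [hBB]; simp [mul_apply, dotProduct, mulVec, mul_comm]
      _ ≤ (fun w => U w v) ⬝ᵥ (fun w => U w v) := hA _
      _ = (Uᵀ * U) v v := by simp [mul_apply, dotProduct]
      _ = 1 := by rw [hU, one_apply_eq]
  have htr : (A * X ^ q * A * X ^ r).trace = ∑ u, ∑ v, B u v ^ 2 * (l v ^ q * l u ^ r) := by
    have : (A * X ^ q * A * X ^ r).trace =
        (B * diagonal (fun u => l u ^ q) * B * diagonal (fun u => l u ^ r)).trace := by
      rw [hpow, hpow]
      calc (A * (U * diagonal (fun u => l u ^ q) * Uᵀ) * A *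
            (U * diagonal (fun u => l u ^ r) * Uᵀ)).trace
          = ((A * U * diagonal (fun u => l u ^ q) * Uᵀ * A * U *
            diagonal (fun u => l u ^ r)) * Uᵀ).trace := by simp only [Matrix.mul_assoc]
        _ = _ := by rw [trace_mul_comm]; simp only [hB, Matrix.mul_assoc]
    rw [this]
    simp only [trace, diag_apply, mul_diagonal, mul_apply (M := B * diagonal _), Finset.sum_mul]
    refine Finset.sum_congr rfl fun u _ => Finset.sum_congr rfl fun v _ => ?_
    rw [hBs v u]; ring
  have hsymm : ∑ u, ∑ v, B u v ^ 2 * (l v ^ q * l u ^ r) =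
      ∑ u, ∑ v, B u v ^ 2 * (l v ^ r * l u ^ q) := by
    rw [Finset.sum_comm]
    refine Finset.sum_congr rfl fun u _ => Finset.sum_congr rfl fun v _ => ?_
    rw [hBs v u]; ring
  have hle : ∑ u, ∑ v, B u v ^ 2 * l v ^ (2 * p) ≤ ∑ v, l v ^ (2 * p) := by
    rw [Finset.sum_comm]
    refine Finset.sum_le_sum fun v _ => ?_
    rw [← Finset.sum_mul]
    exact mul_le_of_le_one_left ((even_two_mul p).pow_nonneg _) (hcol v)
  have hle' : ∑ u, ∑ v, B u v ^ 2 * l u ^ (2 * p) ≤ ∑ v, l v ^ (2 * p) := by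
    refine le_of_eq_of_le ?_ hle
    rw [Finset.sum_comm]
    refine Finset.sum_congr rfl fun u _ => Finset.sum_congr rfl fun v _ => ?_
    rw [hBs v u]
  have hsum : ∑ u, ∑ v, B u v ^ 2 * (l v ^ q * l u ^ r) +
      ∑ u, ∑ v, B u v ^ 2 * (l v ^ r * l u ^ q) ≤
      ∑ u, ∑ v, B u v ^ 2 * l v ^ (2 * p) + ∑ u, ∑ v, B u v ^ 2 * l u ^ (2 * p) := by
    simp only [← Finset.sum_add_distrib, ← mul_add]
    exact Finset.sum_le_sum fun u _ => Finset.sum_le_sum fun v _ =>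
      mul_le_mul_of_nonneg_left (pow_mul_pow_add_pow_mul_pow_le _ _ h) (sq_nonneg _)
  rw [hpow (2 * p), trace_conj_diagonal hU, htr]
  linarith

theorem Matrix.IsSymm.trace_even_pow_nonneg {X : Matrix I I ℝ} (hX : X.IsSymm) (p : ℕ) :
    0 ≤ (X ^ (2 * p)).trace := by
  obtain ⟨U, l, hU, -, hpow⟩ := hX.exists_diagonalization
  rw [hpow, trace_conj_diagonal hU]
  exact Finset.sum_nonneg fun u _ => (even_two_mul p).pow_nonneg _

/-- The `2p`-th Schatten norm bounds the numerical radius. -/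
theorem Matrix.IsSymm.dotProduct_mulVec_pow_le [Nonempty I] {X : Matrix I I ℝ} (hX : X.IsSymm)
    (y : I → ℝ) (p : ℕ) :
    (y ⬝ᵥ X *ᵥ y) ^ (2 * p) ≤ (y ⬝ᵥ y) ^ (2 * p) * (X ^ (2 * p)).trace := by
  obtain ⟨U, l, hU, hU', hpow⟩ := hX.exists_diagonalization
  set z := Uᵀ *ᵥ y with hz
  have hy : y ⬝ᵥ y = ∑ u, z u ^ 2 := by
    calc y ⬝ᵥ y = y ⬝ᵥ ((U * Uᵀ) *ᵥ y) := by rw [hU', one_mulVec]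
      _ = (y ᵥ* U) ⬝ᵥ z := by rw [← mulVec_mulVec, dotProduct_mulVec]
      _ = z ⬝ᵥ z := by rw [hz, mulVec_transpose]
      _ = _ := by simp [dotProduct, sq]
  have hXy : y ⬝ᵥ X *ᵥ y = ∑ u, l u * z u ^ 2 := by
    have h1 := hpow 1
    simp only [pow_one] at h1
    calc y ⬝ᵥ X *ᵥ y = y ⬝ᵥ (U *ᵥ (diagonal l *ᵥ z)) := by
          rw [h1, hz, mulVec_mulVec, mulVec_mulVec]
      _ = z ⬝ᵥ (diagonal l *ᵥ z) := by rw [dotProduct_mulVec, hz, mulVec_transpose]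
      _ = _ := by
        simp only [dotProduct, mulVec_diagonal]
        exact Finset.sum_congr rfl fun u _ => by ring
  obtain ⟨u₀, -, hu₀⟩ := Finset.exists_max_image Finset.univ (fun u => |l u|)
    Finset.univ_nonempty
  have habs : |y ⬝ᵥ X *ᵥ y| ≤ |l u₀| * (y ⬝ᵥ y) := by
    rw [hXy, hy, Finset.mul_sum]
    refine (Finset.abs_sum_le_sum_abs _ _).trans (Finset.sum_le_sum fun u hu => ?_)
    rw [abs_mul, abs_of_nonneg (sq_nonneg (z u))]
    exact mul_le_mul_of_nonneg_right (hu₀ u hu) (sq_nonneg _)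
  calc (y ⬝ᵥ X *ᵥ y) ^ (2 * p) = |y ⬝ᵥ X *ᵥ y| ^ (2 * p) := ((even_two_mul p).pow_abs _).symm
    _ ≤ (|l u₀| * (y ⬝ᵥ y)) ^ (2 * p) := pow_le_pow_left₀ (abs_nonneg _) habs _
    _ = (y ⬝ᵥ y) ^ (2 * p) * l u₀ ^ (2 * p) := by
      rw [mul_pow, (even_two_mul p).pow_abs, mul_comm]
    _ ≤ (y ⬝ᵥ y) ^ (2 * p) * (X ^ (2 * p)).trace := by
      refine mul_le_mul_of_nonneg_left ?_ ((even_two_mul p).pow_nonneg _)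
      rw [hpow, trace_conj_diagonal hU]
      exact Finset.single_le_sum (f := fun u => l u ^ (2 * p))
        (fun u _ => (even_two_mul p).pow_nonneg _) (Finset.mem_univ u₀)

variable {ι : Type*} [Fintype ι]

omit [Fintype ι] in
/-- The product rule for powers of a matrix of polynomials, which does not commute with its
derivative. -/
theorem Matrix.map_pderiv_pow (i : ι) (P : Matrix I I (MvPolynomial ι ℝ)) (n : ℕ) :
    (P ^ n).map (MvPolynomial.pderiv i) =
      ∑ q ∈ Finset.range n, P ^ q * P.map (MvPolynomial.pderiv i) * P ^ (n - 1 - q) := by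
  have hmul : ∀ Q R : Matrix I I (MvPolynomial ι ℝ), (Q * R).map (MvPolynomial.pderiv i) =
      Q.map (MvPolynomial.pderiv i) * R + Q * R.map (MvPolynomial.pderiv i) := fun Q R => by
    ext1 u v
    simp only [map_apply, mul_apply, map_sum, Derivation.leibniz, smul_eq_mul, add_apply,
      Finset.sum_add_distrib]
    rw [add_comm]
    congr 1
    exact Finset.sum_congr rfl fun w _ => mul_comm _ _
  induction n with
  | zero =>
    ext1 u v
    rw [pow_zero, map_apply, Finset.range_zero, Finset.sum_empty, zero_apply, one_apply]
    by_cases h : u = v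
    · rw [if_pos h, Derivation.map_one_eq_zero]
    · rw [if_neg h, map_zero]
  | succ n ih =>
    rw [pow_succ, hmul, ih, Finset.sum_range_succ, Finset.sum_mul]
    have hlast : P ^ n * P.map (MvPolynomial.pderiv i) * P ^ (n + 1 - 1 - n) =
        P ^ n * P.map (MvPolynomial.pderiv i) := by
      rw [Nat.add_sub_cancel, Nat.sub_self, pow_zero, Matrix.mul_one]
    rw [hlast]
    refine congrArg (· + _) (Finset.sum_congr rfl fun q hq => ?_)
    have hq' : n + 1 - 1 - q = n - 1 - q + 1 := by have := Finset.mem_range.1 hq; omega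
    rw [hq', pow_succ, Matrix.mul_assoc]

/-- The matrix `∑ i, x_i A_i` with polynomial entries. -/
noncomputable def matrixSeries (A : ι → Matrix I I ℝ) : Matrix I I (MvPolynomial ι ℝ) :=
  ∑ i, (MvPolynomial.X i : MvPolynomial ι ℝ) • (A i).map MvPolynomial.C

omit [Fintype I] [DecidableEq I] in
theorem map_eval_matrixSeries (A : ι → Matrix I I ℝ) (g : ι → ℝ) :
    (matrixSeries A).map (MvPolynomial.eval g) = ∑ i, g i • A i := by
  ext u v
  simp [matrixSeries, Matrix.sum_apply]

omit [Fintype I] [DecidableEq I] in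
theorem map_pderiv_matrixSeries (A : ι → Matrix I I ℝ) (i : ι) :
    (matrixSeries A).map (MvPolynomial.pderiv i) = (A i).map MvPolynomial.C := by
  classical
  ext1 u v
  simp [matrixSeries, Matrix.sum_apply, MvPolynomial.pderiv_X, Pi.single_apply]

theorem map_eval_matrixSeries_pow (A : ι → Matrix I I ℝ) (g : ι → ℝ) (q : ℕ) :
    (matrixSeries A ^ q).map (MvPolynomial.eval g) = (∑ i, g i • A i) ^ q := by
  rw [← map_eval_matrixSeries]
  exact map_pow (MvPolynomial.eval g).mapMatrix _ q

theorem eval_trace_matrixSeries_pow (A : ι → Matrix I I ℝ) (g : ι → ℝ) (q : ℕ) :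
    MvPolynomial.eval g (matrixSeries A ^ q).trace = ((∑ i, g i • A i) ^ q).trace := by
  rw [← map_eval_matrixSeries_pow]
  simp [trace]

theorem eval_trace_mul_matrixSeries_pow (A : ι → Matrix I I ℝ) (B : Matrix I I ℝ)
    (g : ι → ℝ) (q : ℕ) :
    MvPolynomial.eval g (B.map MvPolynomial.C * matrixSeries A ^ q).trace =
      (B * (∑ i, g i • A i) ^ q).trace := by
  rw [← map_eval_matrixSeries_pow]
  simp [trace, mul_apply]

theorem eval_pderiv_trace_mul_matrixSeries_pow (A : ι → Matrix I I ℝ) (B : Matrix I I ℝ)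
    (g : ι → ℝ) (i : ι) (n : ℕ) :
    MvPolynomial.eval g
        (MvPolynomial.pderiv i (B.map MvPolynomial.C * matrixSeries A ^ n).trace) =
      ∑ q ∈ Finset.range n,
        (B * (∑ i, g i • A i) ^ q * A i * (∑ i, g i • A i) ^ (n - 1 - q)).trace := by
  have h1 : MvPolynomial.pderiv i (B.map MvPolynomial.C * matrixSeries A ^ n).trace =
      (B.map MvPolynomial.C * (matrixSeries A ^ n).map (MvPolynomial.pderiv i)).trace := by
    simp [trace, mul_apply]
  rw [h1, map_pderiv_pow, map_pderiv_matrixSeries, Finset.mul_sum, trace_sum, map_sum]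
  refine Finset.sum_congr rfl fun q _ => ?_
  rw [← map_eval_matrixSeries_pow, ← map_eval_matrixSeries_pow]
  have h2 : ∀ Q : Matrix I I (MvPolynomial ι ℝ),
      MvPolynomial.eval g Q.trace = ((MvPolynomial.eval g).mapMatrix Q).trace := fun Q => by
    simp [trace]
  have h3 : ∀ B : Matrix I I ℝ,
      (MvPolynomial.eval g).mapMatrix (B.map MvPolynomial.C) = B := fun B => by
    ext; simp
  rw [h2]
  simp only [map_mul, h3, RingHom.mapMatrix_apply, Matrix.mul_assoc]

theorem integrable_trace_pow_sum_smul (A : ι → Matrix I I ℝ) (q : ℕ) :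
    Integrable (fun g : EuclideanSpace ℝ ι => ((∑ i, g i • A i) ^ q).trace)
      (stdGaussian (EuclideanSpace ℝ ι)) :=
  (integrable_eval_stdGaussian (matrixSeries A ^ q).trace).congr
    (ae_of_all _ fun g => eval_trace_matrixSeries_pow A (fun i => g i) q)

omit [Fintype I] [DecidableEq I] in
theorem isSymm_sum_smul {A : ι → Matrix I I ℝ} (hA : ∀ i, (A i).IsSymm) (g : ι → ℝ) :
    (∑ i, g i • A i).IsSymm := by
  simp only [Matrix.IsSymm, transpose_sum, transpose_smul, (hA _).eq]

/-- The moment recursion of the matrix Khintchine inequality: Stein's identity applied to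
`tr X ^ (2p+2) = ∑ i, g_i tr (A_i X ^ (2p+1))` produces `2p + 1` traces for each `i`, each of which
is at most `tr X ^ (2p)`. -/
theorem integral_trace_pow_succ_le {A : ι → Matrix I I ℝ} (hA : ∀ i, (A i).IsSymm)
    (hc : ∀ i, (A i).IsContraction) (p : ℕ) :
    ∫ g : EuclideanSpace ℝ ι, ((∑ i, g i • A i) ^ (2 * (p + 1))).trace
        ∂(stdGaussian (EuclideanSpace ℝ ι)) ≤
      (2 * p + 1) * Fintype.card ι *
        ∫ g : EuclideanSpace ℝ ι, ((∑ i, g i • A i) ^ (2 * p)).trace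
          ∂(stdGaussian (EuclideanSpace ℝ ι)) := by
  set P : ι → MvPolynomial ι ℝ :=
    fun i => ((A i).map MvPolynomial.C * matrixSeries A ^ (2 * p + 1)).trace with hP
  have hexp : ∀ g : EuclideanSpace ℝ ι, ((∑ i, g i • A i) ^ (2 * (p + 1))).trace =
      ∑ i, g i * MvPolynomial.eval (fun i => g i) (P i) := fun g => by
    simp only [hP, eval_trace_mul_matrixSeries_pow]
    rw [mul_add, mul_one, ← add_assoc _ 1 1, pow_succ', Finset.sum_mul, trace_sum]
    simp only [smul_mul, trace_smul, smul_eq_mul]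
  have hint : ∀ i, Integrable (fun g : EuclideanSpace ℝ ι =>
      g i * MvPolynomial.eval (fun i => g i) (P i)) (stdGaussian (EuclideanSpace ℝ ι)) :=
    fun i => (integrable_eval_stdGaussian (MvPolynomial.X i * P i)).congr
      (ae_of_all _ fun g => by simp)
  simp only [hexp]
  rw [integral_finsetSum _ fun i _ => hint i]
  simp only [integral_X_mul_eval_stdGaussian]
  have hle : ∀ i, ∫ g : EuclideanSpace ℝ ι,
      MvPolynomial.eval (fun i => g i) (MvPolynomial.pderiv i (P i))
        ∂(stdGaussian (EuclideanSpace ℝ ι)) ≤ (2 * p + 1) *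
        ∫ g : EuclideanSpace ℝ ι, ((∑ i, g i • A i) ^ (2 * p)).trace
          ∂(stdGaussian (EuclideanSpace ℝ ι)) := fun i => by
    rw [← integral_const_mul]
    refine integral_mono (integrable_eval_stdGaussian _)
      ((integrable_trace_pow_sum_smul A _).const_mul _) fun g => ?_
    simp only [hP, eval_pderiv_trace_mul_matrixSeries_pow]
    calc _ ≤ ∑ q ∈ Finset.range (2 * p + 1), ((∑ i, g i • A i) ^ (2 * p)).trace := by
          refine Finset.sum_le_sum fun q hq => (hc i).trace_mul_pow_mul_pow_le (hA i)
            (isSymm_sum_smul hA _) ?_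
          have := Finset.mem_range.1 hq
          omega
      _ = _ := by simp
  calc _ ≤ ∑ _i : ι, (2 * p + 1) *
        ∫ g : EuclideanSpace ℝ ι, ((∑ i, g i • A i) ^ (2 * p)).trace
          ∂(stdGaussian (EuclideanSpace ℝ ι)) := Finset.sum_le_sum fun i _ => hle i
    _ = _ := by rw [Finset.sum_const, Finset.card_univ, nsmul_eq_mul]; ring

theorem integral_trace_pow_le {A : ι → Matrix I I ℝ} (hA : ∀ i, (A i).IsSymm)
    (hc : ∀ i, (A i).IsContraction) (p : ℕ) :
    ∫ g : EuclideanSpace ℝ ι, ((∑ i, g i • A i) ^ (2 * p)).trace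
        ∂(stdGaussian (EuclideanSpace ℝ ι)) ≤
      (2 * p * Fintype.card ι : ℝ) ^ p * Fintype.card I := by
  induction p with
  | zero => simp
  | succ p ih =>
    refine (integral_trace_pow_succ_le hA hc p).trans ?_
    calc _ ≤ (2 * p + 1) * (Fintype.card ι : ℝ) *
          ((2 * p * Fintype.card ι : ℝ) ^ p * Fintype.card I) :=
          mul_le_mul_of_nonneg_left ih (by positivity)
      _ ≤ (2 * (p + 1 : ℕ) * Fintype.card ι : ℝ) *
          ((2 * (p + 1 : ℕ) * Fintype.card ι : ℝ) ^ p * Fintype.card I) := by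
          gcongr <;> push_cast <;> linarith
      _ = _ := by ring

/-- If the linear functionals of `T` are dominated, up to a common shift, by quadratic forms of
`∑ i, g_i A_i` with contractions `A_i`, then the Gaussian width of `T` is at most of the order of the
norm bound `K` given by the `2p`-th moment. The vector `y` may depend on `g`. -/
theorem gaussianWidth_le_of_quadraticForm [Nonempty I] {A : ι → Matrix I I ℝ}
    (hA : ∀ i, (A i).IsSymm) (hc : ∀ i, (A i).IsContraction)
    {T : Set (EuclideanSpace ℝ ι)} (hT : T.Finite) (hne : T.Nonempty)
    (c : EuclideanSpace ℝ ι) {β M K : ℝ} (hβ : 0 ≤ β) (hM : 0 < M) (hK : 0 < K)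
    {p : ℕ} (hp : 1 ≤ p)
    (hKp : (2 * p * Fintype.card ι : ℝ) ^ p * Fintype.card I ≤ K ^ (2 * p))
    (h : ∀ x ∈ T, ∀ g : EuclideanSpace ℝ ι, ∃ y : I → ℝ, y ⬝ᵥ y = M ∧
      inner ℝ x g ≤ inner ℝ c g + β * (y ⬝ᵥ (∑ i, g i • A i) *ᵥ y)) :
    gaussianWidth T ≤ β * M * (2 * K) := by
  set F : EuclideanSpace ℝ ι → ℝ := fun g => ((∑ i, g i • A i) ^ (2 * p)).trace with hF
  have hFi : Integrable F (stdGaussian (EuclideanSpace ℝ ι)) :=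
    integrable_trace_pow_sum_smul A (2 * p)
  have hci : Integrable (fun g => inner ℝ c g) (stdGaussian (EuclideanSpace ℝ ι)) :=
    (IsGaussian.integrable_id (μ := stdGaussian (EuclideanSpace ℝ ι))).const_inner c
  have hpt : ∀ g, sSup ((fun x => inner ℝ x g) '' T) ≤
      inner ℝ c g + β * M * (K + F g / K ^ (2 * p - 1)) := fun g => by
    refine csSup_le (hne.image _) ?_
    -- Uses `s ≤ K + s ^ (2p) / K ^ (2p-1)` for the normalized quadratic form `s`.
    rintro _ ⟨x, hx, rfl⟩
    obtain ⟨y, hy, hxy⟩ := h x hx g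
    refine hxy.trans (add_le_add le_rfl ?_)
    rw [mul_assoc]
    refine mul_le_mul_of_nonneg_left ?_ hβ
    have hX := isSymm_sum_smul hA g
    have h1 := hX.dotProduct_mulVec_pow_le y p
    have hF0 : 0 ≤ F g := hX.trace_even_pow_nonneg p
    rw [hy] at h1
    set z := y ⬝ᵥ (∑ i, g i • A i) *ᵥ y
    rcases le_total z (M * K) with hz | hz
    · refine hz.trans (mul_le_mul_of_nonneg_left ?_ hM.le)
      have : 0 ≤ F g / K ^ (2 * p - 1) := by positivity
      linarith
    · have hMK : 0 < M * K := by positivity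
      have hz' : z ≤ M * (F g / K ^ (2 * p - 1)) := by
        have h2 : z * (M * K) ^ (2 * p - 1) ≤ M ^ (2 * p) * F g := by
          refine le_trans ?_ h1
          calc z * (M * K) ^ (2 * p - 1) ≤ z * z ^ (2 * p - 1) :=
                mul_le_mul_of_nonneg_left (pow_le_pow_left₀ hMK.le hz _) (hMK.le.trans hz)
            _ = z ^ (2 * p) := by rw [← pow_succ']; congr 1; omega
        rw [← mul_div_assoc, le_div_iff₀ (by positivity)]
        have h3 : M ^ (2 * p) = M * M ^ (2 * p - 1) := by
          rw [← pow_succ']; congr 1; omega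
        rw [h3, mul_pow] at h2
        have h4 : 0 < M ^ (2 * p - 1) := by positivity
        nlinarith
      refine hz'.trans (mul_le_mul_of_nonneg_left ?_ hM.le)
      linarith
  have hEF : ∫ g, F g ∂(stdGaussian (EuclideanSpace ℝ ι)) ≤ K ^ (2 * p) :=
    (integral_trace_pow_le hA hc p).trans hKp
  calc gaussianWidth T
      ≤ ∫ g, (inner ℝ c g + β * M * (K + F g / K ^ (2 * p - 1)))
          ∂(stdGaussian (EuclideanSpace ℝ ι)) :=
        integral_mono (integrable_sSup_inner_of_finite hT hne)
          (hci.add (((integrable_const K).add (hFi.div_const _)).const_mul _)) hpt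
    _ = β * M * (K + (∫ g, F g ∂(stdGaussian (EuclideanSpace ℝ ι))) / K ^ (2 * p - 1)) := by
        have hKi : Integrable (fun g => K + F g / K ^ (2 * p - 1))
            (stdGaussian (EuclideanSpace ℝ ι)) := (integrable_const K).add (hFi.div_const _)
        rw [integral_add hci (hKi.const_mul _), integral_const_mul,
          integral_add (integrable_const K) (hFi.div_const _), integral_div, integral_const]
        have : ∫ g, inner ℝ c g ∂(stdGaussian (EuclideanSpace ℝ ι)) = 0 :=
          integral_strongDual_stdGaussian (innerSL ℝ c)
        simp [this]
    _ ≤ β * M * (2 * K) := by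
        refine mul_le_mul_of_nonneg_left ?_ (by positivity)
        have : (∫ g, F g ∂(stdGaussian (EuclideanSpace ℝ ι))) / K ^ (2 * p - 1) ≤ K := by
          rw [div_le_iff₀ (by positivity), ← pow_succ']
          rwa [show 2 * p - 1 + 1 = 2 * p by omega]
        linarith

end Khintchine

/-! ### The Kikuchi matrix of a family of half-edges -/

open Matrix in
theorem Matrix.isContraction_of_sum_row_le_one {I : Type*} [Fintype I] {A : Matrix I I ℝ}
    (hA : A.IsSymm) (h0 : ∀ u w, 0 ≤ A u w) (h1 : ∀ u, ∑ w, A u w ≤ 1) : A.IsContraction := by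
  intro v
  calc (A *ᵥ v) ⬝ᵥ (A *ᵥ v) = ∑ u, (∑ w, A u w * v w) ^ 2 := by simp [dotProduct, mulVec, sq]
    _ ≤ ∑ u, ∑ w, A u w * v w ^ 2 := by
      refine Finset.sum_le_sum fun u _ => ?_
      have h := Finset.sum_sq_le_sum_mul_sum_of_sq_le_mul Finset.univ
        (r := fun w => A u w * v w) (f := fun w => A u w) (g := fun w => A u w * v w ^ 2)
        (fun w _ => h0 u w) (fun w _ => mul_nonneg (h0 u w) (sq_nonneg _))
        (fun w _ => le_of_eq (by ring))
      exact h.trans (mul_le_of_le_one_left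
        (Finset.sum_nonneg fun w _ => mul_nonneg (h0 u w) (sq_nonneg _)) (h1 u))
    _ = ∑ w, (∑ u, A w u) * v w ^ 2 := by
      rw [Finset.sum_comm]
      simp only [Finset.sum_mul]
      exact Finset.sum_congr rfl fun w _ => Finset.sum_congr rfl fun u _ => by rw [hA.apply]
    _ ≤ ∑ w, v w ^ 2 :=
      Finset.sum_le_sum fun w _ => mul_le_of_le_one_left (sq_nonneg _) (h1 w)
    _ = v ⬝ᵥ v := by simp [dotProduct, sq]

section Kikuchi

variable {k m : ℕ} {V J : Type*}

/-- Let the edge `j` have the two halves `e j true` and `e j false`, each with one vertex in each of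
`k` rows. The table `u` contains the half `b` of the edge `j` at the places `p`, where
`f = (j, b, p)` and `p a` is the place used in row `a`. -/
def Hits (e : J → Bool → Fin k → V) (f : J × Bool × (Fin k → Fin m))
    (u : Fin k → Fin m → V) : Prop :=
  ∀ a, u a (f.2.2 a) = e f.1 f.2.1 a

/-- The table `u` with the entries at the places of `f = (j, b, p)` replaced by the half of the edge
`j` opposite to `b`. -/
def swapHalf (e : J → Bool → Fin k → V) (f : J × Bool × (Fin k → Fin m))
    (u : Fin k → Fin m → V) : Fin k → Fin m → V :=
  fun a => Function.update (u a) (f.2.2 a) (e f.1 (!f.2.1) a)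

/-- The same edge and places, with the opposite half. -/
def flipSide (f : J × Bool × (Fin k → Fin m)) : J × Bool × (Fin k → Fin m) :=
  (f.1, !f.2.1, f.2.2)

theorem flipSide_flipSide (f : J × Bool × (Fin k → Fin m)) : flipSide (flipSide f) = f := by
  simp [flipSide]

theorem hits_flipSide_swapHalf (e : J → Bool → Fin k → V) (f : J × Bool × (Fin k → Fin m))
    (u : Fin k → Fin m → V) : Hits e (flipSide f) (swapHalf e f u) := fun a => by
  simp [flipSide, swapHalf]

theorem Hits.swapHalf_swapHalf {e : J → Bool → Fin k → V} {f : J × Bool × (Fin k → Fin m)}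
    {u : Fin k → Fin m → V} (h : Hits e f u) :
    swapHalf e (flipSide f) (swapHalf e f u) = u := by
  funext a
  simp only [swapHalf, flipSide, Function.update_idem, Bool.not_not]
  rw [← h a, Function.update_eq_self]

theorem hits_and_eq_swapHalf_iff (e : J → Bool → Fin k → V) (f : J × Bool × (Fin k → Fin m))
    (u w : Fin k → Fin m → V) :
    Hits e (flipSide f) w ∧ u = swapHalf e (flipSide f) w ↔ Hits e f u ∧ w = swapHalf e f u := by
  constructor
  · rintro ⟨h, rfl⟩
    refine ⟨?_, ?_⟩
    · simpa [flipSide_flipSide] using hits_flipSide_swapHalf e (flipSide f) w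
    · simpa [flipSide_flipSide] using h.swapHalf_swapHalf.symm
  · rintro ⟨h, rfl⟩
    exact ⟨hits_flipSide_swapHalf e f u, h.swapHalf_swapHalf.symm⟩

open Classical in
/-- The degree of a table: the number of ways in which it contains a half of an edge. -/
noncomputable def hitDegree [Fintype J] (e : J → Bool → Fin k → V) (u : Fin k → Fin m → V) : ℝ :=
  ∑ f : J × Bool × (Fin k → Fin m), if Hits e f u then 1 else 0

theorem hitDegree_nonneg [Fintype J] (e : J → Bool → Fin k → V) (u : Fin k → Fin m → V) :
    0 ≤ hitDegree e u := by
  classical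
  exact Finset.sum_nonneg fun f _ => by split_ifs <;> norm_num

theorem Hits.one_le_hitDegree [Fintype J] {e : J → Bool → Fin k → V}
    {f : J × Bool × (Fin k → Fin m)} {u : Fin k → Fin m → V} (h : Hits e f u) :
    1 ≤ hitDegree e u := by
  classical
  have := Finset.single_le_sum (f := fun f => if Hits e f u then (1 : ℝ) else 0)
    (fun f _ => by split_ifs <;> norm_num) (Finset.mem_univ f)
  simpa [hitDegree, h] using this

open Classical in
/-- The total weight with which the edge `j` occurs in the quadratic form of the Kikuchi matrix when
adjacent tables `u`, `w` get the entry `1 / (deg u + deg w)`. -/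
noncomputable def edgeWeight (m : ℕ) [Fintype J] [Fintype V] (e : J → Bool → Fin k → V)
    (j : J) : ℝ :=
  ∑ b : Bool, ∑ p : Fin k → Fin m, ∑ u : Fin k → Fin m → V,
    if Hits e (j, b, p) u then (hitDegree e u + hitDegree e (swapHalf e (j, b, p) u))⁻¹ else 0

open Classical in
/-- The Kikuchi matrix: `u` and `w` are adjacent if `w` arises from `u` by exchanging one half of an
edge for the other. The entry is normalized by the sum of the two degrees, and the edge `j` is
counted with the coefficient `α j`. -/
noncomputable def kikuchiMatrix (m : ℕ) [Fintype J] (e : J → Bool → Fin k → V) (α : J → ℝ) :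
    Matrix (Fin k → Fin m → V) (Fin k → Fin m → V) ℝ :=
  fun u w => ∑ f : J × Bool × (Fin k → Fin m),
    if Hits e f u ∧ w = swapHalf e f u then α f.1 * (hitDegree e u + hitDegree e w)⁻¹ else 0

theorem isSymm_kikuchiMatrix [Fintype J] (e : J → Bool → Fin k → V) (α : J → ℝ) :
    (kikuchiMatrix m e α).IsSymm := by
  classical
  refine Matrix.IsSymm.ext fun u w => ?_
  have hbij : Function.Bijective (flipSide : J × Bool × (Fin k → Fin m) → _) :=
    Function.Involutive.bijective flipSide_flipSide
  unfold kikuchiMatrix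
  rw [← hbij.sum_comp]
  refine Finset.sum_congr rfl fun f _ => ?_
  simp only [hits_and_eq_swapHalf_iff e f u w, add_comm (hitDegree e w)]
  rfl

theorem kikuchiMatrix_nonneg [Fintype J] (e : J → Bool → Fin k → V) {α : J → ℝ}
    (hα : ∀ j, 0 ≤ α j) (u w : Fin k → Fin m → V) : 0 ≤ kikuchiMatrix m e α u w := by
  classical
  refine Finset.sum_nonneg fun f _ => ?_
  split_ifs
  · exact mul_nonneg (hα _)
      (inv_nonneg.2 (add_nonneg (hitDegree_nonneg e u) (hitDegree_nonneg e w)))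
  · exact le_rfl

open Classical in
theorem sum_kikuchiMatrix_mul [Fintype J] [Fintype V] (e : J → Bool → Fin k → V) (α : J → ℝ)
    (u : Fin k → Fin m → V) (z : (Fin k → Fin m → V) → ℝ) :
    ∑ w, kikuchiMatrix m e α u w * z w = ∑ f : J × Bool × (Fin k → Fin m),
      if Hits e f u then α f.1 * (hitDegree e u + hitDegree e (swapHalf e f u))⁻¹ *
        z (swapHalf e f u) else 0 := by
  simp only [kikuchiMatrix, Finset.sum_mul]
  rw [Finset.sum_comm]
  refine Finset.sum_congr rfl fun f _ => ?_
  by_cases h : Hits e f u <;> simp [h, ite_mul]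

/-- The row sum at `u` is at most the degree of `u` times the inverse of this degree. -/
theorem isContraction_kikuchiMatrix [Fintype J] [Fintype V] (e : J → Bool → Fin k → V)
    {α : J → ℝ} (hα : ∀ j, 0 ≤ α j) (hα1 : ∀ j, α j ≤ 1) :
    (kikuchiMatrix m e α).IsContraction := by
  classical
  refine Matrix.isContraction_of_sum_row_le_one (isSymm_kikuchiMatrix e α)
    (kikuchiMatrix_nonneg e hα) fun u => ?_
  have h := sum_kikuchiMatrix_mul e α u (fun _ => 1)
  simp only [mul_one] at h
  rw [h]
  calc _ ≤ ∑ f : J × Bool × (Fin k → Fin m),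
        (if Hits e f u then (1 : ℝ) else 0) * (hitDegree e u)⁻¹ := by
        refine Finset.sum_le_sum fun f _ => ?_
        split_ifs with hf
        · have h1 := hf.one_le_hitDegree
          have h2 := hitDegree_nonneg e (swapHalf e f u)
          exact mul_le_mul (hα1 _) (inv_anti₀ (by linarith) (by linarith))
            (inv_nonneg.2 (by linarith)) zero_le_one
        · simp
    _ = hitDegree e u * (hitDegree e u)⁻¹ := by rw [← Finset.sum_mul]; rfl
    _ ≤ 1 := mul_inv_le_one

/-- The character of a table: the product of `x` over all its entries. -/
def tableProd (x : V → ℝ) (u : Fin k → Fin m → V) : ℝ := ∏ a, ∏ q, x (u a q)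

theorem tableProd_sq {x : V → ℝ} (hx : ∀ v, x v ^ 2 = 1) (u : Fin k → Fin m → V) :
    tableProd x u ^ 2 = 1 := by
  simp [tableProd, ← Finset.prod_pow, hx]

theorem Hits.tableProd_mul_swapHalf {x : V → ℝ} (hx : ∀ v, x v ^ 2 = 1)
    {e : J → Bool → Fin k → V} {f : J × Bool × (Fin k → Fin m)} {u : Fin k → Fin m → V}
    (h : Hits e f u) :
    tableProd x u * tableProd x (swapHalf e f u) = ∏ b, ∏ a, x (e f.1 b a) := by
  have hB : ∏ b, ∏ a, x (e f.1 b a) =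
      ∏ a, (x (e f.1 f.2.1 a) * x (e f.1 (!f.2.1) a)) := by
    rw [Finset.prod_mul_distrib, Fintype.prod_bool]
    cases f.2.1 <;> simp [mul_comm]
  rw [hB, tableProd, tableProd, ← Finset.prod_mul_distrib]
  refine Finset.prod_congr rfl fun a _ => ?_
  rw [← Finset.prod_mul_distrib, Finset.prod_eq_single (f.2.2 a)]
  · simp [swapHalf, h a]
  · intro q _ hq
    simp only [swapHalf, Function.update_of_ne hq]
    rw [← sq, hx]
  · simp

open Matrix in
theorem tableProd_dotProduct_kikuchiMatrix [Fintype J] [Fintype V] {x : V → ℝ}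
    (hx : ∀ v, x v ^ 2 = 1) (e : J → Bool → Fin k → V) (α : J → ℝ) :
    tableProd x ⬝ᵥ kikuchiMatrix m e α *ᵥ tableProd x =
      ∑ j, α j * edgeWeight m e j * ∏ b, ∏ a, x (e j b a) := by
  classical
  have h1 : tableProd x ⬝ᵥ kikuchiMatrix m e α *ᵥ tableProd x =
      ∑ u, ∑ f : J × Bool × (Fin k → Fin m),
        α f.1 * (∏ b, ∏ a, x (e f.1 b a)) *
        if Hits e f u then (hitDegree e u + hitDegree e (swapHalf e f u))⁻¹ else 0 := by
    simp only [dotProduct, mulVec, sum_kikuchiMatrix_mul, Finset.mul_sum]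
    refine Finset.sum_congr rfl fun u _ => Finset.sum_congr rfl fun f _ => ?_
    split_ifs with hf
    · rw [← hf.tableProd_mul_swapHalf hx]; ring
    · simp
  rw [h1, Finset.sum_comm, Fintype.sum_prod_type]
  refine Finset.sum_congr rfl fun j _ => ?_
  simp only [← Finset.mul_sum, Fintype.sum_prod_type, edgeWeight]
  ring

section Counting
variable [Fintype V] [DecidableEq V]

/-- A prescribed value at one place has density `1 / card V`. -/
theorem card_filter_apply_eq (q : Fin m) (v : V) :
    (Fintype.card V : ℝ) * ∑ w : Fin m → V, (if w q = v then (1 : ℝ) else 0) =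
      (Fintype.card V : ℝ) ^ m := by
  have h : ∀ w : Fin m → V, (if w q = v then (1 : ℝ) else 0) =
      ∏ r, if r = q then (if w r = v then (1 : ℝ) else 0) else 1 := fun w => by
    simp
  simp only [h]
  rw [← Fintype.piFinset_univ, ← Finset.prod_univ_sum (fun _ => Finset.univ)
    (fun r (x : V) => if r = q then (if x = v then (1 : ℝ) else 0) else 1),
    ← Finset.mul_prod_erase _ _ (Finset.mem_univ q)]
  rw [Finset.prod_congr rfl (g := fun _ => (Fintype.card V : ℝ)) fun r hr => by
    simp [Finset.ne_of_mem_erase hr]]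
  have hm : m - 1 + 1 = m := Nat.sub_add_cancel (by have := q.2; omega)
  simp only [if_true, Finset.sum_ite_eq', Finset.mem_univ, Finset.prod_const,
    Finset.card_erase_of_mem, Finset.card_univ, Fintype.card_fin, one_mul]
  rw [← pow_succ', hm]

/-- Prescribed values at two places have density `1 / (card V) ^ 2`. -/
theorem card_filter_apply_eq_and_eq {q q' : Fin m} (hq : q' ≠ q) (v v' : V) :
    (Fintype.card V : ℝ) ^ 2 *
      ∑ w : Fin m → V, ((if w q = v then (1 : ℝ) else 0) * if w q' = v' then 1 else 0) =
      (Fintype.card V : ℝ) ^ m := by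
  have h : ∀ w : Fin m → V,
      ((if w q = v then (1 : ℝ) else 0) * if w q' = v' then 1 else 0) =
      ∏ r, (if r = q then (if w r = v then (1 : ℝ) else 0) else 1) *
        (if r = q' then (if w r = v' then (1 : ℝ) else 0) else 1) := fun w => by
    rw [Finset.prod_mul_distrib, Finset.prod_ite_eq', Finset.prod_ite_eq']
    simp only [Finset.mem_univ, if_true]
  simp only [h]
  rw [← Fintype.piFinset_univ, ← Finset.prod_univ_sum (fun _ => Finset.univ)
    (fun r (x : V) => (if r = q then (if x = v then (1 : ℝ) else 0) else 1) *
        (if r = q' then (if x = v' then (1 : ℝ) else 0) else 1)),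
    ← Finset.mul_prod_erase _ _ (Finset.mem_univ q),
    ← Finset.mul_prod_erase _ _ (Finset.mem_erase.2 ⟨hq, Finset.mem_univ q'⟩)]
  rw [Finset.prod_congr rfl (g := fun _ => (Fintype.card V : ℝ)) fun r hr => by
    simp [Finset.ne_of_mem_erase hr, Finset.ne_of_mem_erase (Finset.mem_of_mem_erase hr)]]
  have hm : m - 1 - 1 + 2 = m := by
    have := q.2; have := q'.2; have := Fin.val_ne_of_ne hq; omega
  simp only [if_true, if_neg hq, if_neg hq.symm, one_mul, mul_one, Finset.sum_ite_eq',
    Finset.mem_univ, Finset.prod_const, Finset.card_erase_of_mem,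
    Finset.mem_erase.2 ⟨hq, Finset.mem_univ q'⟩, Finset.card_univ, Fintype.card_fin]
  rw [mul_comm, ← pow_add, hm]

theorem sum_apply_eq_and_eq_le [Nonempty V] (q : Fin m) (v v' : V) :
    ∑ q' : Fin m, ∑ w : Fin m → V,
      ((if w q = v then (1 : ℝ) else 0) * if w q' = v' then 1 else 0) ≤
      (Fintype.card V : ℝ) ^ m / Fintype.card V *
        (m / Fintype.card V + if v = v' then 1 else 0) := by
  have hN : 0 < (Fintype.card V : ℝ) := by exact_mod_cast Fintype.card_pos
  have hone : ∑ w : Fin m → V, (if w q = v then (1 : ℝ) else 0) =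
      (Fintype.card V : ℝ) ^ m / Fintype.card V := by
    rw [eq_div_iff hN.ne', mul_comm, card_filter_apply_eq]
  calc _ ≤ ∑ q' : Fin m, ((Fintype.card V : ℝ) ^ m / Fintype.card V * (1 / Fintype.card V) +
        if q' = q then (Fintype.card V : ℝ) ^ m / Fintype.card V *
          (if v = v' then 1 else 0) else 0) := by
        refine Finset.sum_le_sum fun q' _ => ?_
        by_cases hq : q' = q
        · subst hq
          rw [if_pos rfl]
          have : ∑ w : Fin m → V,
              ((if w q' = v then (1 : ℝ) else 0) * if w q' = v' then 1 else 0) =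
              (Fintype.card V : ℝ) ^ m / Fintype.card V * (if v = v' then 1 else 0) := by
            rw [← hone, Finset.sum_mul]
            refine Finset.sum_congr rfl fun w _ => ?_
            by_cases h : w q' = v <;> simp [h]
          rw [this]
          have : 0 ≤ (Fintype.card V : ℝ) ^ m / Fintype.card V * (1 / Fintype.card V) := by
            positivity
          linarith
        · rw [if_neg hq, add_zero]
          have := card_filter_apply_eq_and_eq hq v v'
          refine le_of_eq ?_
          rw [← mul_one_div, ← this]
          field_simp
    _ = _ := by
        rw [Finset.sum_add_distrib, Finset.sum_const, Finset.sum_ite_eq' Finset.univ q,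
          if_pos (Finset.mem_univ q), Finset.card_univ, Fintype.card_fin, nsmul_eq_mul]
        ring

omit [Fintype V] in
open Classical in
theorem hits_indicator_eq_prod (e : J → Bool → Fin k → V) (f : J × Bool × (Fin k → Fin m))
    (u : Fin k → Fin m → V) : (if Hits e f u then (1 : ℝ) else 0) =
      ∏ a, if u a (f.2.2 a) = e f.1 f.2.1 a then (1 : ℝ) else 0 := by
  by_cases h : Hits e f u
  · rw [if_pos h]
    exact (Finset.prod_eq_one fun a _ => if_pos (h a)).symm
  · rw [if_neg h]
    obtain ⟨a, ha⟩ := not_forall.1 h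
    exact (Finset.prod_eq_zero (Finset.mem_univ a) (if_neg ha)).symm

open Classical in
theorem sum_hits [Nonempty V] (e : J → Bool → Fin k → V) (f : J × Bool × (Fin k → Fin m)) :
    ∑ u : Fin k → Fin m → V, (if Hits e f u then (1 : ℝ) else 0) =
      ((Fintype.card V : ℝ) ^ m / Fintype.card V) ^ k := by
  have hN : 0 < (Fintype.card V : ℝ) := by exact_mod_cast Fintype.card_pos
  simp only [hits_indicator_eq_prod]
  rw [← Fintype.piFinset_univ, ← Finset.prod_univ_sum (fun _ => Finset.univ)
    (fun a (w : Fin m → V) => if w (f.2.2 a) = e f.1 f.2.1 a then (1 : ℝ) else 0)]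
  rw [Finset.prod_congr rfl (g := fun _ => (Fintype.card V : ℝ) ^ m / Fintype.card V)
    fun a _ => by rw [eq_div_iff hN.ne', mul_comm, card_filter_apply_eq]]
  rw [Finset.prod_const, Finset.card_univ, Fintype.card_fin]

open Classical in
/-- Given a half at fixed places, the expected number of places `p'` at which a second half occurs.
Rows are independent, and in each row `p'` either agrees with the first half, which forces the two
vertices to coincide, or contributes at most `m / card V`. -/
theorem sum_hits_mul_hits_le [Nonempty V] (e : J → Bool → Fin k → V)
    (f : J × Bool × (Fin k → Fin m)) (j' : J) (b' : Bool) :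
    ∑ p' : Fin k → Fin m, ∑ u : Fin k → Fin m → V,
      ((if Hits e f u then (1 : ℝ) else 0) * if Hits e (j', b', p') u then 1 else 0) ≤
      ((Fintype.card V : ℝ) ^ m / Fintype.card V) ^ k *
        ∏ a, (m / Fintype.card V + if e f.1 f.2.1 a = e j' b' a then (1 : ℝ) else 0) := by
  have h : ∀ (p' : Fin k → Fin m) (u : Fin k → Fin m → V),
      ((if Hits e f u then (1 : ℝ) else 0) * if Hits e (j', b', p') u then 1 else 0) =
      ∏ a, ((if u a (f.2.2 a) = e f.1 f.2.1 a then (1 : ℝ) else 0) *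
        if u a (p' a) = e j' b' a then 1 else 0) := fun p' u => by
    rw [Finset.prod_mul_distrib, hits_indicator_eq_prod, hits_indicator_eq_prod]
  have h2 : ∀ p' : Fin k → Fin m, ∑ u : Fin k → Fin m → V,
      ((if Hits e f u then (1 : ℝ) else 0) * if Hits e (j', b', p') u then 1 else 0) =
      ∏ a, ∑ w : Fin m → V, ((if w (f.2.2 a) = e f.1 f.2.1 a then (1 : ℝ) else 0) *
        if w (p' a) = e j' b' a then 1 else 0) := fun p' => by
    simp only [h]
    rw [← Fintype.piFinset_univ, ← Finset.prod_univ_sum (fun _ => Finset.univ)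
      (fun a (w : Fin m → V) => (if w (f.2.2 a) = e f.1 f.2.1 a then (1 : ℝ) else 0) *
        if w (p' a) = e j' b' a then 1 else 0)]
  simp only [h2]
  rw [← Fintype.piFinset_univ, ← Finset.prod_univ_sum (fun _ => Finset.univ)
    (fun a (q : Fin m) => ∑ w : Fin m → V,
      ((if w (f.2.2 a) = e f.1 f.2.1 a then (1 : ℝ) else 0) *
        if w q = e j' b' a then 1 else 0))]
  calc _ ≤ ∏ a : Fin k, ((Fintype.card V : ℝ) ^ m / Fintype.card V *
        (m / Fintype.card V + if e f.1 f.2.1 a = e j' b' a then (1 : ℝ) else 0)) :=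
        Finset.prod_le_prod
          (fun a _ => Finset.sum_nonneg fun q _ => Finset.sum_nonneg fun w _ => by positivity)
          (fun a _ => sum_apply_eq_and_eq_le _ _ _)
    _ = _ := by
        rw [Finset.prod_mul_distrib, Finset.prod_const, Finset.card_univ, Fintype.card_fin]

theorem prod_add_ite_le {ρ : ℝ} (h0 : 0 ≤ ρ) (h1 : ρ ≤ 1) (P : Fin k → Prop) [DecidablePred P] :
    ∏ a, (ρ + if P a then (1 : ℝ) else 0) ≤ ρ ^ k + 2 ^ k * ∑ a, if P a then (1 : ℝ) else 0 := by
  by_cases h : ∃ a, P a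
  · obtain ⟨a, ha⟩ := h
    have hs : (1 : ℝ) ≤ ∑ a, if P a then (1 : ℝ) else 0 := by
      have := Finset.single_le_sum (f := fun a => if P a then (1 : ℝ) else 0)
        (fun a _ => by positivity) (Finset.mem_univ a)
      simpa [ha] using this
    calc _ ≤ ∏ _a : Fin k, (2 : ℝ) := Finset.prod_le_prod (fun a _ => by positivity)
          (fun a _ => by split_ifs <;> linarith)
      _ = 2 ^ k * 1 := by simp
      _ ≤ 2 ^ k * ∑ a, if P a then (1 : ℝ) else 0 :=
        mul_le_mul_of_nonneg_left hs (by positivity)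
      _ ≤ _ := le_add_of_nonneg_left (by positivity)
  · push Not at h
    simp [h]

open Classical in
/-- On average, a table that contains a given half-edge has degree at most `2t (1 + k 2^k)`. Halves
disjoint from the given one contribute at most `t N (m / N) ^ k ≤ t` for each side, since there are
at most `t N` edges. At most `k t` halves for each side share a vertex with the given one in the same
row, and each of these occurs at most `2 ^ k` times on average. -/
theorem sum_hits_mul_hitDegree_le [Nonempty V] [Fintype J] {e : J → Bool → Fin k → V} {t : ℕ}
    (hk : 1 ≤ k) (hmN : m ^ k ≤ Fintype.card V ^ (k - 1))
    (he : ∀ b a v, (Finset.univ.filter fun j => e j b a = v).card ≤ t)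
    (f : J × Bool × (Fin k → Fin m)) :
    ∑ u : Fin k → Fin m → V, (if Hits e f u then hitDegree e u else 0) ≤
      2 * t * (1 + k * 2 ^ k) * ((Fintype.card V : ℝ) ^ m / Fintype.card V) ^ k := by
  have hN : 0 < (Fintype.card V : ℝ) := by exact_mod_cast Fintype.card_pos
  set N : ℝ := ((Fintype.card V : ℕ) : ℝ) with hNdef
  set ρ : ℝ := m / N with hρ
  have hρ0 : 0 ≤ ρ := by positivity
  have hρk : N * ρ ^ k ≤ 1 := by
    rw [hρ, div_pow, ← mul_div_assoc, div_le_one (by positivity)]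
    have h : (m : ℝ) ^ k ≤ N ^ (k - 1) := by rw [hNdef]; exact_mod_cast hmN
    calc N * m ^ k ≤ N * N ^ (k - 1) := mul_le_mul_of_nonneg_left h hN.le
      _ = N ^ k := by rw [← pow_succ']; congr 1; omega
  have hρ1 : ρ ≤ 1 := by
    have hN1 : 1 ≤ N := by rw [hNdef]; exact_mod_cast Fintype.card_pos
    have : ρ ^ k ≤ 1 := by
      refine le_trans ?_ hρk
      exact le_mul_of_one_le_left (by positivity) hN1
    exact (pow_le_one_iff_of_nonneg hρ0 (by omega)).1 this
  have hJ : (Fintype.card J : ℝ) ≤ t * N := by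
    have h := Finset.card_eq_sum_card_fiberwise (f := fun j => e j true ⟨0, hk⟩)
      (s := Finset.univ) (t := Finset.univ) (fun _ _ => Finset.mem_coe.2 (Finset.mem_univ _))
    have h2 : Fintype.card J ≤ ∑ _v : V, t := by
      rw [← Finset.card_univ, h]
      exact Finset.sum_le_sum fun v _ => he _ _ v
    rw [Finset.sum_const, Finset.card_univ, smul_eq_mul] at h2
    rw [hNdef, mul_comm]
    exact_mod_cast h2
  have hside : ∀ b' : Bool, ∑ j' : J,
      ∏ a, (ρ + if e f.1 f.2.1 a = e j' b' a then (1 : ℝ) else 0) ≤ t * (1 + k * 2 ^ k) := by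
    intro b'
    calc _ ≤ ∑ j' : J, (ρ ^ k + 2 ^ k *
          ∑ a, if e f.1 f.2.1 a = e j' b' a then (1 : ℝ) else 0) :=
          Finset.sum_le_sum fun j' _ => prod_add_ite_le hρ0 hρ1 _
      _ = Fintype.card J * ρ ^ k + 2 ^ k *
          ∑ a, ∑ j' : J, if e j' b' a = e f.1 f.2.1 a then (1 : ℝ) else 0 := by
          rw [Finset.sum_add_distrib, ← Finset.mul_sum, Finset.sum_comm]
          simp [eq_comm]
      _ ≤ t * 1 + 2 ^ k * ∑ _a : Fin k, (t : ℝ) := by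
          refine add_le_add ?_ (mul_le_mul_of_nonneg_left
            (Finset.sum_le_sum fun a _ => ?_) (by positivity))
          · calc _ ≤ t * N * ρ ^ k := mul_le_mul_of_nonneg_right hJ (by positivity)
              _ = t * (N * ρ ^ k) := by ring
              _ ≤ t * 1 := mul_le_mul_of_nonneg_left hρk (by positivity)
          · rw [Finset.sum_boole]
            exact_mod_cast he b' a _
      _ = _ := by simp; ring
  calc ∑ u : Fin k → Fin m → V, (if Hits e f u then hitDegree e u else 0)
      = ∑ j' : J, ∑ b' : Bool, ∑ p' : Fin k → Fin m, ∑ u : Fin k → Fin m → V,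
        ((if Hits e f u then (1 : ℝ) else 0) * if Hits e (j', b', p') u then 1 else 0) := by
        have : ∀ u : Fin k → Fin m → V, (if Hits e f u then hitDegree e u else 0) =
            ∑ j' : J, ∑ b' : Bool, ∑ p' : Fin k → Fin m,
            ((if Hits e f u then (1 : ℝ) else 0) * if Hits e (j', b', p') u then 1 else 0) := by
          intro u
          simp only [← Finset.mul_sum, hitDegree, Fintype.sum_prod_type]
          split_ifs <;> simp
        simp only [this]
        rw [Finset.sum_comm]
        refine Finset.sum_congr rfl fun j' _ => ?_
        rw [Finset.sum_comm]
        refine Finset.sum_congr rfl fun b' _ => ?_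
        rw [Finset.sum_comm]
    _ ≤ ∑ j' : J, ∑ b' : Bool, (N ^ m / N) ^ k *
        ∏ a, (ρ + if e f.1 f.2.1 a = e j' b' a then (1 : ℝ) else 0) :=
        Finset.sum_le_sum fun j' _ => Finset.sum_le_sum fun b' _ =>
          sum_hits_mul_hits_le e f j' b'
    _ = ∑ b' : Bool, (N ^ m / N) ^ k * ∑ j' : J,
        ∏ a, (ρ + if e f.1 f.2.1 a = e j' b' a then (1 : ℝ) else 0) := by
        rw [Finset.sum_comm]
        simp only [Finset.mul_sum]
    _ ≤ ∑ _b' : Bool, (N ^ m / N) ^ k * (t * (1 + k * 2 ^ k)) :=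
        Finset.sum_le_sum fun b' _ => mul_le_mul_of_nonneg_left (hside b') (by positivity)
    _ = _ := by simp; ring

omit [DecidableEq V] in
open Classical in
/-- Swapping is a bijection between the tables with one half and those with the other. -/
theorem sum_hits_mul_hitDegree_swapHalf [Fintype J] (e : J → Bool → Fin k → V)
    (f : J × Bool × (Fin k → Fin m)) :
    ∑ u : Fin k → Fin m → V, (if Hits e f u then hitDegree e (swapHalf e f u) else 0) =
      ∑ u : Fin k → Fin m → V, (if Hits e (flipSide f) u then hitDegree e u else 0) := by
  rw [← Finset.sum_filter, ← Finset.sum_filter]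
  refine Finset.sum_nbij' (swapHalf e f) (swapHalf e (flipSide f)) ?_ ?_ ?_ ?_ ?_
  · exact fun u _ => by simpa using hits_flipSide_swapHalf e f u
  · exact fun u _ => by simpa [flipSide_flipSide] using hits_flipSide_swapHalf e (flipSide f) u
  · exact fun u hu => Hits.swapHalf_swapHalf (by simpa using hu)
  · intro u hu
    have : Hits e (flipSide f) u := by simpa using hu
    simpa [flipSide_flipSide] using this.swapHalf_swapHalf
  · exact fun u _ => rfl

/-- Every edge keeps a weight of order `1 / t` per occurrence, by the convexity of `s ↦ 1 / s` and the
bound on the average degree. -/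
theorem le_edgeWeight [Nonempty V] [Fintype J] {e : J → Bool → Fin k → V} {t : ℕ}
    (hk : 1 ≤ k) (ht : 1 ≤ t) (hmN : m ^ k ≤ Fintype.card V ^ (k - 1))
    (he : ∀ b a v, (Finset.univ.filter fun j => e j b a = v).card ≤ t) (j : J) :
    m ^ k * ((Fintype.card V : ℝ) ^ m / Fintype.card V) ^ k / (2 * t * (1 + k * 2 ^ k)) ≤
      edgeWeight m e j := by
  classical
  have hN : 0 < (Fintype.card V : ℝ) := by exact_mod_cast Fintype.card_pos
  set S : ℝ := ((Fintype.card V : ℝ) ^ m / Fintype.card V) ^ k with hS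
  have hS0 : 0 < S := by positivity
  have ht0 : (0 : ℝ) < t := by exact_mod_cast ht
  set K : ℝ := 1 + k * 2 ^ k with hK
  have hK0 : 0 < K := by positivity
  have hf : ∀ f : J × Bool × (Fin k → Fin m), S / (4 * t * K) ≤
      ∑ u : Fin k → Fin m → V,
        if Hits e f u then (hitDegree e u + hitDegree e (swapHalf e f u))⁻¹ else 0 := by
    intro f
    have hle : ∑ u with Hits e f u, (hitDegree e u + hitDegree e (swapHalf e f u)) ≤
        4 * t * K * S := by
      rw [Finset.sum_add_distrib, Finset.sum_filter, Finset.sum_filter,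
        sum_hits_mul_hitDegree_swapHalf]
      have h1 := sum_hits_mul_hitDegree_le hk hmN he f
      have h2 := sum_hits_mul_hitDegree_le hk hmN he (flipSide f)
      linarith
    have hpos : ∀ u ∈ Finset.univ.filter (Hits e f),
        0 < hitDegree e u + hitDegree e (swapHalf e f u) := fun u hu => by
      have h1 := (Finset.mem_filter.1 hu).2.one_le_hitDegree
      have h2 := hitDegree_nonneg e (swapHalf e f u)
      linarith
    have hcard : ∑ u with Hits e f u, (1 : ℝ) = S := by
      rw [Finset.sum_filter, sum_hits]
    have htitu := Finset.sq_sum_div_le_sum_sq_div (Finset.univ.filter (Hits e f))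
      (fun _ => (1 : ℝ)) hpos
    rw [hcard] at htitu
    rw [← Finset.sum_filter]
    calc S / (4 * t * K) = S ^ 2 / (4 * t * K * S) := by field_simp
      _ ≤ S ^ 2 / ∑ u with Hits e f u, (hitDegree e u + hitDegree e (swapHalf e f u)) := by
        refine div_le_div_of_nonneg_left (by positivity) ?_ hle
        refine Finset.sum_pos hpos ?_
        by_contra hemp
        rw [Finset.not_nonempty_iff_eq_empty] at hemp
        rw [hemp, Finset.sum_empty] at hcard
        exact hS0.ne hcard
      _ ≤ _ := by simpa using htitu
  calc _ = ∑ _b : Bool, ∑ _p : Fin k → Fin m, S / (4 * t * K) := by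
        simp only [Finset.sum_const, Finset.card_univ, Fintype.card_bool, Fintype.card_pi_const,
          Fintype.card_fin, nsmul_eq_mul, Nat.cast_pow, Nat.cast_ofNat]
        field_simp
        norm_num
    _ ≤ _ := Finset.sum_le_sum fun b _ => Finset.sum_le_sum fun p _ => hf (j, b, p)

end Counting

open Matrix in
/-- A family of edges with bounded degrees is represented exactly by the quadratic form of a
contraction on the characters `tableProd x`; the coefficients `α j` of the Kikuchi matrix compensate
for the unequal edge weights. -/
theorem exists_contraction_quadraticForm [Fintype V] [DecidableEq V] [Nonempty V] [Fintype J]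
    {e : J → Bool → Fin k → V} {t : ℕ} (hk : 1 ≤ k) (hm : 1 ≤ m) (ht : 1 ≤ t)
    (hmN : m ^ k ≤ Fintype.card V ^ (k - 1))
    (he : ∀ b a v, (Finset.univ.filter fun j => e j b a = v).card ≤ t) :
    ∃ A : Matrix (Fin k → Fin m → V) (Fin k → Fin m → V) ℝ, A.IsSymm ∧ A.IsContraction ∧
      ∀ x : V → ℝ, (∀ v, x v ^ 2 = 1) → tableProd x ⬝ᵥ A *ᵥ tableProd x =
        m ^ k * ((Fintype.card V : ℝ) ^ m / Fintype.card V) ^ k / (2 * t * (1 + k * 2 ^ k)) *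
          ∑ j, ∏ b, ∏ a, x (e j b a) := by
  have hN : 0 < (Fintype.card V : ℝ) := by exact_mod_cast Fintype.card_pos
  have ht0 : (0 : ℝ) < t := by exact_mod_cast ht
  have hm0 : (0 : ℝ) < m := by exact_mod_cast hm
  set w₀ : ℝ := m ^ k * ((Fintype.card V : ℝ) ^ m / Fintype.card V) ^ k /
    (2 * t * (1 + k * 2 ^ k)) with hw
  have hw0 : 0 < w₀ := by positivity
  have hle : ∀ j, w₀ ≤ edgeWeight m e j := le_edgeWeight hk ht hmN he
  refine ⟨kikuchiMatrix m e fun j => w₀ / edgeWeight m e j, isSymm_kikuchiMatrix _ _,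
    isContraction_kikuchiMatrix _ (fun j => div_nonneg hw0.le (hw0.le.trans (hle j)))
      (fun j => div_le_one_of_le₀ (hle j) (hw0.le.trans (hle j))), fun x hx => ?_⟩
  rw [tableProd_dotProduct_kikuchiMatrix hx, Finset.mul_sum]
  refine Finset.sum_congr rfl fun j _ => ?_
  rw [div_mul_cancel₀ _ (hw0.trans_le (hle j)).ne']

end Kikuchi

/-! ### From gradients on the cube to quadratic forms -/

section Reduction

/-- A multi-affine function on the cube `[-1, 1]^W` is at most one of its values at sign vectors: the
point `x` is the mean of independent signs with means `x i`. -/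
theorem exists_sign_sum_mul_prod_le {W E : Type*} [Fintype W] [DecidableEq W] [Fintype E]
    (c : E → ℝ) (s : E → Finset W) {x : W → ℝ} (hx : ∀ i, |x i| ≤ 1) :
    ∃ ε : W → ℝ, (∀ i, ε i ^ 2 = 1) ∧
      ∑ j, c j * ∏ i ∈ s j, x i ≤ ∑ j, c j * ∏ i ∈ s j, ε i := by
  set sgn : Bool → ℝ := fun b => if b then 1 else -1 with hsgn
  set wt : W → Bool → ℝ := fun i b => (1 + sgn b * x i) / 2 with hwt
  have hwt0 : ∀ i b, 0 ≤ wt i b := fun i b => by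
    have := abs_le.1 (hx i)
    cases b <;> simp only [hwt, hsgn] <;> norm_num <;> linarith
  set w : (W → Bool) → ℝ := fun σ => ∏ i, wt i (σ i) with hw
  have hmean : ∀ t : Finset W, ∑ σ, w σ * ∏ i ∈ t, sgn (σ i) = ∏ i ∈ t, x i := fun t => by
    have h1 : ∀ σ : W → Bool, w σ * ∏ i ∈ t, sgn (σ i) =
        ∏ i, wt i (σ i) * (if i ∈ t then sgn (σ i) else 1) := fun σ => by
      rw [Finset.prod_mul_distrib, Finset.prod_ite_mem, Finset.univ_inter]
    simp only [h1]
    rw [← Fintype.piFinset_univ, ← Finset.prod_univ_sum (fun _ => Finset.univ)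
      (fun i b => wt i b * (if i ∈ t then sgn b else 1))]
    have h2 : ∏ i ∈ t, x i = ∏ i, if i ∈ t then x i else 1 := by
      rw [Finset.prod_ite_mem, Finset.univ_inter]
    rw [h2]
    refine Finset.prod_congr rfl fun i _ => ?_
    simp only [Fintype.sum_bool, hwt, hsgn]
    by_cases hi : i ∈ t <;> simp [hi] <;> ring
  have hw1 : ∑ σ, w σ = 1 := by simpa using hmean ∅
  obtain ⟨σ, -, hσ⟩ := Finset.exists_max_image Finset.univ
    (fun σ : W → Bool => ∑ j, c j * ∏ i ∈ s j, sgn (σ i)) Finset.univ_nonempty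
  refine ⟨fun i => sgn (σ i), fun i => by cases h : σ i <;> simp [hsgn], ?_⟩
  calc ∑ j, c j * ∏ i ∈ s j, x i
      = ∑ τ, w τ * ∑ j, c j * ∏ i ∈ s j, sgn (τ i) := by
        simp only [← hmean, Finset.mul_sum]
        rw [Finset.sum_comm]
        exact Finset.sum_congr rfl fun τ _ => Finset.sum_congr rfl fun j _ => by ring
    _ ≤ ∑ τ, w τ * ∑ j, c j * ∏ i ∈ s j, sgn (σ i) :=
        Finset.sum_le_sum fun τ hτ => mul_le_mul_of_nonneg_left (hσ τ hτ)
          (Finset.prod_nonneg fun i _ => hwt0 i _)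
    _ = _ := by rw [← Finset.sum_mul, hw1, one_mul]

/-- A nonempty set of at most `2k` vertices is written into `2 × k` slots; the vertices of `W × Bool`
with second component `false` are the dummies, on which `x` is taken to be `1`. Dummies too have
their first component in `s`, so that the degree of a dummy is bounded by the degree of a vertex. -/
theorem exists_padded_enumeration {W : Type*} {s : Finset W} (hs : s.Nonempty)
    {k : ℕ} (hk : s.card ≤ 2 * k) :
    ∃ en : Bool → Fin k → W × Bool, (∀ b a, (en b a).1 ∈ s) ∧
      ∀ x : W → ℝ, ∏ b, ∏ a, (if (en b a).2 then x (en b a).1 else 1) = ∏ i ∈ s, x i := by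
  obtain ⟨v₀, hv₀⟩ := hs
  obtain ⟨f⟩ := Function.Embedding.nonempty_of_card_le
    (α := s) (β := Bool × Fin k) (by simpa using hk)
  set F : Bool × Fin k → W × Bool :=
    Function.extend f (fun v => ((v : W), true)) (fun _ => (v₀, false)) with hF
  have hFin : ∀ v, F (f v) = ((v : W), true) := fun v => f.injective.extend_apply _ _ v
  have hFout : ∀ c, (¬∃ v, f v = c) → F c = (v₀, false) := fun c hc =>
    Function.extend_apply' _ _ _ hc
  refine ⟨fun b a => F (b, a), fun b a => ?_, fun x => ?_⟩
  · by_cases h : ∃ v, f v = (b, a)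
    · obtain ⟨v, hv⟩ := h
      simp only [← hv, hFin]
      exact v.2
    · simp only [hFout _ h]
      exact hv₀
  · rw [← Fintype.prod_prod_type' (f := fun b a => if (F (b, a)).2 then x (F (b, a)).1 else 1),
      ← Finset.prod_subset (Finset.subset_univ (Finset.univ.map f)), Finset.prod_map]
    · simp only [Prod.mk.eta, hFin, if_true]
      exact Finset.prod_coe_sort s x
    · intro c _ hc
      rw [hFout c (by simpa using hc)]
      simp

theorem pderiv_prod_X {W : Type*} [DecidableEq W] (i : W) (s : Finset W) :
    MvPolynomial.pderiv i (∏ j ∈ s, (MvPolynomial.X j : MvPolynomial W ℝ)) =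
      if i ∈ s then ∏ j ∈ s.erase i, MvPolynomial.X j else 0 := by
  have h0 : ∀ t : Finset W, i ∉ t →
      MvPolynomial.pderiv i (∏ j ∈ t, (MvPolynomial.X j : MvPolynomial W ℝ)) = 0 := fun t => by
    induction t using Finset.induction_on with
    | empty => simp
    | insert a t ha ih =>
      intro h
      rw [Finset.mem_insert, not_or] at h
      rw [Finset.prod_insert ha, Derivation.leibniz, ih h.2,
        MvPolynomial.pderiv_X_of_ne (Ne.symm h.1)]
      simp
  split_ifs with h
  · rw [← Finset.mul_prod_erase s _ h, Derivation.leibniz, h0 _ (Finset.notMem_erase i s),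
      MvPolynomial.pderiv_X_self]
    simp
  · exact h0 s h

namespace MultiHypergraph

theorem exists_edges_eq_map {V : Type*} (H : MultiHypergraph V) :
    ∃ (r : ℕ) (E : Fin r → Finset V), H.edges = Finset.univ.val.map E := by
  refine ⟨H.edges.toList.length, H.edges.toList.get, ?_⟩
  rw [Fin.univ_val_map, List.ofFn_get, Multiset.coe_toList]

theorem polyGradient_apply {V : Type*} [DecidableEq V] {H : MultiHypergraph V} {r : ℕ}
    {E : Fin r → Finset V} (hE : H.edges = Finset.univ.val.map E) (x : EuclideanSpace ℝ V)
    (i : V) : polyGradient H.poly x i =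
      ∑ j, if i ∈ E j then ∏ v ∈ (E j).erase i, x v else 0 := by
  have hp : H.poly = ∑ j, ∏ v ∈ E j, MvPolynomial.X v := by
    rw [poly, hE, Multiset.map_map]; rfl
  simp only [polyGradient, hp, map_sum, pderiv_prod_X]
  refine Finset.sum_congr rfl fun j _ => ?_
  split_ifs <;> simp

theorem codegree_eq_card {V : Type*} [DecidableEq V] {H : MultiHypergraph V} {r : ℕ}
    {E : Fin r → Finset V} (hE : H.edges = Finset.univ.val.map E) (i v : V) :
    H.codegree i v = (Finset.univ.filter fun j => i ∈ E j ∧ v ∈ E j).card := by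
  rw [codegree, hE, Multiset.countP_map]; rfl

end MultiHypergraph

open Matrix in
/-- The bound for general parameters `m` (columns of the tables), `p` (order of the moment) and `K`
(bound on the norm). -/
theorem gaussianWidth_polyGradient_le {n k m t p : ℕ} {K : ℝ} (hn : 1 ≤ n) (hk : 1 ≤ k)
    (hm : 1 ≤ m) (ht : 1 ≤ t) (hmN : m ^ k ≤ (2 * n) ^ (k - 1)) (hp : 1 ≤ p) (hK : 0 < K)
    (hKp : (2 * p * n : ℝ) ^ p * ((2 * n : ℝ) ^ m) ^ k ≤ K ^ (2 * p))
    {H : MultiHypergraph (Fin n)} (hH : H.IsBounded (2 * k + 1))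
    (hcod : ∀ i j : Fin n, i ≠ j → H.codegree i j ≤ t) :
    gaussianWidth (polyGradient H.poly '' booleanCube (Fin n)) ≤
      2 * t * (1 + k * 2 ^ k) * ((2 * n : ℝ) ^ k / m ^ k) * (2 * K) := by
  obtain ⟨r, E, hE⟩ := H.exists_edges_eq_map
  have : Nonempty (Fin n) := ⟨⟨0, hn⟩⟩
  -- The link of `i`; edges equal to `{i}` only contribute to the constant `c i`.
  let J : Fin n → Type := fun i => {j : Fin r // i ∈ E j ∧ ((E j).erase i).Nonempty}
  have hcard : ∀ i (j : J i), ((E j.1).erase i).card ≤ 2 * k := fun i j => by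
    have h1 : (E j.1).card ≤ 2 * k + 1 := hH _ (by
      rw [hE]; exact Multiset.mem_map_of_mem _ (Finset.mem_univ_val _))
    rw [Finset.card_erase_of_mem j.2.1]
    omega
  choose en hen hprod using fun i (j : J i) => exists_padded_enumeration j.2.2 (hcard i j)
  have hdeg : ∀ i b a (v : Fin n × Bool),
      (Finset.univ.filter fun j : J i => en i j b a = v).card ≤ t := by
    intro i b a v
    -- The codegree hypothesis says nothing about `i` itself, but `i` is not in its own link.
    by_cases hv : i = v.1
    · refine le_of_eq_of_le (Finset.card_eq_zero.2 ?_) (Nat.zero_le t)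
      refine Finset.filter_eq_empty_iff.2 fun j _ hj => ?_
      have := hen i j b a
      rw [hj, ← hv] at this
      exact Finset.notMem_erase i _ this
    · refine le_trans ?_ (hcod i v.1 hv)
      rw [MultiHypergraph.codegree_eq_card hE]
      refine Finset.card_le_card_of_injOn Subtype.val (fun j hj => ?_)
        (Subtype.val_injective.injOn)
      have h1 := hen i j b a
      rw [(Finset.mem_filter.1 hj).2] at h1
      simpa using And.intro j.2.1 (Finset.mem_of_mem_erase h1)
  have hN : Fintype.card (Fin n × Bool) = 2 * n := by simp [mul_comm]
  have hNr : (Fintype.card (Fin n × Bool) : ℝ) = 2 * n := by rw [hN]; push_cast; ring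
  choose A hAs hAc hAq using fun i => exists_contraction_quadraticForm (m := m) hk hm ht
    (by rw [hN]; exact hmN) (hdeg i)
  simp only [hNr] at hAq
  have hn0 : (0 : ℝ) < n := by exact_mod_cast hn
  have hm0 : (0 : ℝ) < m := by exact_mod_cast hm
  have ht0 : (0 : ℝ) < t := by exact_mod_cast ht
  set w₀ : ℝ := m ^ k * ((2 * n : ℝ) ^ m / (2 * n)) ^ k / (2 * t * (1 + k * 2 ^ k)) with hw
  have hw0 : 0 < w₀ := by positivity
  set c : EuclideanSpace ℝ (Fin n) := WithLp.toLp 2 fun i =>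
    ∑ j, if i ∈ E j ∧ ¬((E j).erase i).Nonempty then 1 else 0 with hc
  have hgrad : ∀ (x : EuclideanSpace ℝ (Fin n)) i, polyGradient H.poly x i =
      c i + ∑ j : J i, ∏ v ∈ (E j.1).erase i, x v := fun x i => by
    rw [MultiHypergraph.polyGradient_apply hE]
    have h1 : ∑ j : J i, ∏ v ∈ (E j.1).erase i, x v =
        ∑ j, if i ∈ E j ∧ ((E j).erase i).Nonempty then ∏ v ∈ (E j).erase i, x v else 0 := by
      rw [← Finset.sum_filter]
      exact (Finset.sum_subtype _ (fun j => by simp) fun j => ∏ v ∈ (E j).erase i, x v).symm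
    rw [h1, hc]
    simp only
    rw [← Finset.sum_add_distrib]
    refine Finset.sum_congr rfl fun j _ => ?_
    by_cases h2 : i ∈ E j
    · by_cases h3 : ((E j).erase i).Nonempty
      · simp only [h2, h3]; simp
      · simp only [h2, h3]
        rw [Finset.not_nonempty_iff_eq_empty.1 h3]; simp
    · simp [h2]
  have hbound := gaussianWidth_le_of_quadraticForm hAs hAc
    ((finite_booleanCube (Fin n)).image (polyGradient H.poly))
    ((nonempty_booleanCube (Fin n)).image _) c (β := w₀⁻¹)
    (M := ((2 * n : ℝ) ^ m) ^ k) (K := K) (inv_nonneg.2 hw0.le) (by positivity) hK hp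
    (by simpa [mul_comm] using hKp) ?_
  · refine hbound.trans (le_of_eq ?_)
    rw [hw, div_pow]
    field_simp
  · rintro _ ⟨x, hx, rfl⟩ g
    have hinner : ∀ z : EuclideanSpace ℝ (Fin n), inner ℝ z g = ∑ i, g i * z i := fun z => by
      simp [PiLp.inner_apply]
    obtain ⟨ε, hε, hle⟩ := exists_sign_sum_mul_prod_le
      (fun j : (i : Fin n) × J i => g j.1) (fun j => (E j.2.1).erase j.1) (x := fun i => x i)
      (fun i => by rcases hx i with h | h <;> simp [h])
    simp only [Fintype.sum_sigma, ← Finset.mul_sum] at hle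
    set ε' : Fin n × Bool → ℝ := fun v => if v.2 then ε v.1 else 1 with hε'
    have hε2 : ∀ v, ε' v ^ 2 = 1 := fun v => by
      simp only [hε']; split_ifs <;> simp [hε]
    refine ⟨tableProd ε', ?_, ?_⟩
    · simp only [dotProduct, ← sq, tableProd_sq hε2]
      simp [mul_comm]
    · rw [hinner, hinner]
      simp only [hgrad, mul_add, Finset.sum_add_distrib]
      refine add_le_add le_rfl (hle.trans (le_of_eq ?_))
      have hq : tableProd ε' ⬝ᵥ (∑ i, g i • A i) *ᵥ tableProd ε' =
          ∑ i, g i * (tableProd ε' ⬝ᵥ A i *ᵥ tableProd ε') := by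
        simp only [sum_mulVec, dotProduct_sum, smul_mulVec, dotProduct_smul, smul_eq_mul]
      rw [hq, Finset.mul_sum]
      refine Finset.sum_congr rfl fun i _ => ?_
      rw [hAq i ε' hε2]
      simp only [hε', hprod]
      field_simp

theorem gaussianWidth_singleton {ι : Type*} [Fintype ι] (c : EuclideanSpace ℝ ι) :
    gaussianWidth {c} = 0 := by
  simp only [gaussianWidth, Set.image_singleton, csSup_singleton]
  exact integral_strongDual_stdGaussian (innerSL ℝ c)

end Reduction

/-! ### The choice of the parameters -/

/-- The number of columns is `m = ⌊(2n) ^ (1 - 1/k)⌋`, the largest for which the average degree of the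
Kikuchi matrix stays bounded. -/
theorem exists_scale {n k : ℕ} (hn : 2 ≤ n) (hk : 1 ≤ k) :
    ∃ m : ℕ, 1 ≤ m ∧ m ^ k ≤ (2 * n) ^ (k - 1) ∧
      (2 * n : ℝ) ^ k / m ^ k ≤ 2 ^ k * (2 * n) ∧
      (m : ℝ) ≤ 2 * (n : ℝ) ^ (1 - 1 / (k : ℝ)) := by
  have hk0 : (0 : ℝ) < k := by exact_mod_cast hk
  have hn0 : (2 : ℝ) ≤ n := by exact_mod_cast hn
  set θ : ℝ := 1 - 1 / k with hθ
  have hθ0 : 0 ≤ θ := by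
    rw [hθ, sub_nonneg, div_le_one hk0]; exact_mod_cast hk
  have hθ1 : θ ≤ 1 := by rw [hθ]; have : 0 < 1 / (k : ℝ) := by positivity
                         linarith
  set s : ℝ := (2 * n : ℝ) ^ θ with hs
  have hs1 : 1 ≤ s := Real.one_le_rpow (by linarith) hθ0
  have hsk : s ^ k = (2 * n : ℝ) ^ (k - 1) := by
    rw [hs, ← Real.rpow_natCast, ← Real.rpow_mul (by linarith), ← Real.rpow_natCast]
    congr 1
    rw [hθ, Nat.cast_sub hk]
    field_simp
    simp
  have hms : (⌊s⌋₊ : ℝ) ≤ s := Nat.floor_le (by linarith)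
  have hm1 : 1 ≤ ⌊s⌋₊ := Nat.one_le_floor_iff _ |>.2 hs1
  have hm1' : (1 : ℝ) ≤ ⌊s⌋₊ := by exact_mod_cast hm1
  refine ⟨⌊s⌋₊, hm1, ?_, ?_, ?_⟩
  · have : (⌊s⌋₊ : ℝ) ^ k ≤ (2 * n : ℝ) ^ (k - 1) := by
      rw [← hsk]; exact pow_le_pow_left₀ (by linarith) hms k
    exact_mod_cast this
  · rw [div_le_iff₀ (by positivity)]
    have h2 : s ≤ 2 * ⌊s⌋₊ := by have := Nat.lt_floor_add_one s; linarith
    calc (2 * n : ℝ) ^ k = 2 * n * (2 * n) ^ (k - 1) := by rw [← pow_succ']; congr 1; omega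
      _ = 2 * n * s ^ k := by rw [hsk]
      _ ≤ 2 * n * (2 * ⌊s⌋₊) ^ k := by gcongr
      _ = _ := by rw [mul_pow]; ring
  · refine hms.trans ?_
    rw [hs, Real.mul_rpow (by norm_num) (by linarith)]
    refine mul_le_mul_of_nonneg_right ?_ (by positivity)
    exact (Real.rpow_le_rpow_of_exponent_le (by norm_num) hθ1).trans (by simp)

/-- The order of the moment is the logarithm of the matrix size, rounded up, so that the factor
`(2n) ^ (m k)` in the trace costs only a constant. -/
theorem exists_moment {n k m : ℕ} (hn : 2 ≤ n) (hk : 1 ≤ k) (hm1 : 1 ≤ m)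
    (hm : (m : ℝ) ≤ 2 * (n : ℝ) ^ (1 - 1 / (k : ℝ))) :
    ∃ (p : ℕ) (K : ℝ), 1 ≤ p ∧ 0 < K ∧
      (2 * p * n : ℝ) ^ p * ((2 * n : ℝ) ^ m) ^ k ≤ K ^ (2 * p) ∧
      K ≤ √(16 * Real.exp 1 * k) *
        ((n : ℝ) ^ (1 - 1 / (2 * (k : ℝ))) * √(Real.log n)) := by
  have hk0 : (1 : ℝ) ≤ k := by exact_mod_cast hk
  have hn0 : (2 : ℝ) ≤ n := by exact_mod_cast hn
  have hm0 : (1 : ℝ) ≤ m := by exact_mod_cast hm1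
  have hlogn : 0 < Real.log n := Real.log_pos (by linarith)
  have hlog2n : Real.log (2 * n) ≤ 2 * Real.log n := by
    rw [Real.log_mul (by norm_num) (by linarith)]
    have := Real.log_le_log (by norm_num) hn0
    linarith
  have hlog1 : 1 ≤ Real.log (2 * n) := by
    rw [Real.le_log_iff_exp_le (by linarith)]
    have := Real.exp_one_lt_d9
    linarith
  set ℓ : ℝ := m * k * Real.log (2 * n) with hℓ
  have hℓ1 : 1 ≤ ℓ := by
    have : 1 ≤ (m : ℝ) * k := one_le_mul_of_one_le_of_one_le hm0 hk0
    exact one_le_mul_of_one_le_of_one_le this hlog1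
  have hexp : ((2 * n : ℝ) ^ m) ^ k = Real.exp ℓ := by
    rw [← pow_mul, hℓ, ← Nat.cast_mul, ← Real.rpow_natCast,
      Real.rpow_def_of_pos (by linarith), mul_comm]
  set p := ⌈ℓ⌉₊ with hp
  have hpℓ : ℓ ≤ p := Nat.le_ceil ℓ
  have hp1 : 1 ≤ p := by exact_mod_cast hℓ1.trans hpℓ
  have hp1' : (1 : ℝ) ≤ p := by exact_mod_cast hp1
  have hp2 : (p : ℝ) ≤ 2 * ℓ := by
    have := Nat.ceil_lt_add_one (zero_le_one.trans hℓ1)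
    linarith
  refine ⟨p, √(2 * p * n * Real.exp 1), hp1, by positivity, ?_, ?_⟩
  · rw [pow_mul, Real.sq_sqrt (by positivity), mul_pow _ (Real.exp 1), ← Real.exp_nat_mul, mul_one,
      hexp]
    gcongr
  · rw [← Real.sqrt_sq (show 0 ≤ (n : ℝ) ^ (1 - 1 / (2 * (k : ℝ))) by positivity),
      ← Real.sqrt_mul (by positivity), ← Real.sqrt_mul (by positivity)]
    refine Real.sqrt_le_sqrt ?_
    have hpow : (n : ℝ) ^ (1 - 1 / (k : ℝ)) * n = ((n : ℝ) ^ (1 - 1 / (2 * (k : ℝ)))) ^ 2 := by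
      nth_rewrite 2 [← Real.rpow_one (n : ℝ)]
      rw [← Real.rpow_add (by linarith), ← Real.rpow_natCast, ← Real.rpow_mul (by linarith)]
      congr 1
      push_cast
      field_simp
      ring
    calc 2 * p * n * Real.exp 1 ≤ 2 * (2 * ℓ) * n * Real.exp 1 := by gcongr
      _ ≤ 2 * (2 * ((2 * (n : ℝ) ^ (1 - 1 / (k : ℝ))) * k * (2 * Real.log n))) * n *
          Real.exp 1 := by rw [hℓ]; gcongr
      _ = _ := by rw [← hpow]; ring

theorem mainTheorem5 (d : ℕ) (hd : 1 ≤ d) :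
    ∃ C : ℝ, 0 < C ∧
      ∀ (n t : ℕ), 1 ≤ n → 1 ≤ t →
        ∀ H : MultiHypergraph (Fin n), H.IsBounded (d + 1) →
          (∀ i j : Fin n, i ≠ j → H.codegree i j ≤ t) →
            (1 / (n : ℝ)) * gaussianWidth (polyGradient H.poly '' booleanCube (Fin n)) ≤
              C * ((t : ℝ) * (n : ℝ) ^ (1 - 1 / (2 * (⌈(d : ℝ) / 2⌉₊ : ℝ))) *
                Real.sqrt (Real.log (n : ℝ))) := by
  have hd0 : (1 : ℝ) ≤ d := by exact_mod_cast hd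
  set k := ⌈(d : ℝ) / 2⌉₊ with hkdef
  have hk : 1 ≤ k := Nat.one_le_iff_ne_zero.2 (Nat.ceil_pos.2 (by linarith)).ne'
  have hk0 : (0 : ℝ) < k := by exact_mod_cast hk
  have hdk : d ≤ 2 * k := by
    have := Nat.le_ceil ((d : ℝ) / 2)
    have h2 : (d : ℝ) ≤ 2 * k := by rw [hkdef]; linarith
    exact_mod_cast h2
  refine ⟨2 ^ (k + 3) * (1 + k * 2 ^ k) * √(16 * Real.exp 1 * k), by positivity, ?_⟩
  intro n t hn ht H hH hcod
  rcases hn.eq_or_lt with rfl | hn2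
  -- For `n = 1` the right side vanishes, and so does the width, as the gradient is constant.
  · have hconst : polyGradient H.poly '' booleanCube (Fin 1) = {polyGradient H.poly 0} := by
      obtain ⟨r, E, hE⟩ := H.exists_edges_eq_map
      refine Set.eq_singleton_iff_nonempty_unique_mem.2
        ⟨(nonempty_booleanCube _).image _, ?_⟩
      rintro _ ⟨x, -, rfl⟩
      ext i
      rw [MultiHypergraph.polyGradient_apply hE, MultiHypergraph.polyGradient_apply hE]
      refine Finset.sum_congr rfl fun j _ => ?_
      have hempty : (E j).erase i = ∅ := Finset.eq_empty_of_forall_notMem fun v hv =>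
        Finset.ne_of_mem_erase hv (Subsingleton.elim v i)
      rw [hempty, Finset.prod_empty, Finset.prod_empty]
    rw [hconst, gaussianWidth_singleton]
    simp
  · obtain ⟨m, hm1, hmN, hratio, hm⟩ := exists_scale hn2 hk
    obtain ⟨p, K, hp, hK, hKp, hKle⟩ := exists_moment hn2 hk hm1 hm
    have hmain := gaussianWidth_polyGradient_le hn hk hm1 ht hmN hp hK hKp
      (fun e he => (hH e he).trans (by omega)) hcod
    have hn0 : (0 : ℝ) < n := by exact_mod_cast hn
    rw [one_div, inv_mul_le_iff₀ hn0]
    calc _ ≤ 2 * t * (1 + k * 2 ^ k) * ((2 * n : ℝ) ^ k / m ^ k) * (2 * K) := hmain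
      _ ≤ 2 * t * (1 + k * 2 ^ k) * (2 ^ k * (2 * n)) * (2 * (√(16 * Real.exp 1 * k) *
          ((n : ℝ) ^ (1 - 1 / (2 * (k : ℝ))) * √(Real.log n)))) := by gcongr
      _ = _ := by ring
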